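/- For $\epsilon\in\{1,-1\}$ let $\langle x,y\rangle_\epsilon=x_1y_1+x_2y_2+\epsilon x_3y_3$ on $\mathbb R^3$, and let $M^2(1)=\mathbb S^2=\{x\in\mathbb R^3 : \langle x,x\rangle_1=1\}$ and $M^2(-1)=\mathbb H^2=\{x\in\mathbb R^3 : \langle x,x\rangle_{-1}=-1,\ x_3>0\}$, with the induced Riemannian metrics of constant curvature $1$ and $-1$. Equip $M^2(\epsilon)\times M^2(\epsilon)$ with the product metric. Let $N$ be a smooth $3$-manifold and let $\Psi:N\to M^2(\epsilon)\times M^2(\epsilon)$ be a smooth immersion with second fundamental form $\sigma$ and mean curvature vector $H=\frac13\operatorname{trace}\sigma$. Suppose that $\Psi$ is totally umbilical, i.e. $\sigma(v,w)=\langle v,w\rangle H$ for all tangent vectors $v,w$ of $N$ at the same point, and that it has constant mean curvature, i.e. $|H|$ is constant. Then $\Psi$ is totally geodesic, i.e. $\sigma=0$, and it is locally congruent to the totally geodesic immersion $$M^2(\epsilon)\times\mathbb R\to M^2(\epsilon)\times M^2(\epsilon),\qquad (p,t)\mapsto\begin{cases}(p,(\cos t,\sin t,0)) & \text{if }\epsilon=1,\\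 (p,(0,\sinh t,\cosh t)) & \text{if }\epsilon=-1.\end{cases}$$ More precisely, denote this immersion by $\iota$. Every point of $N$ has an open neighbourhood $U$, a diffeomorphism $\varphi$ from $U$ onto an open subset of $M^2(\epsilon)\times\mathbb R$, and an isometry $L$ of $M^2(\epsilon)\times M^2(\epsilon)$, which is the restriction of a linear isometry of $(\mathbb R^3\times\mathbb R^3,\ \langle\cdot,\cdot\rangle_\epsilon\oplus\langle\cdot,\cdot\rangle_\epsilon)$, such that $\Psi|_U=L\circ\iota\circ\varphi$. -/

import Mathlib

open scoped Manifold ContDiff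

noncomputable section

namespace ProductSurfaces

/-- The vector space `ℝ³`. Its metric is never the norm of this type but `form ε` below. -/
abbrev E3 := Fin 3 → ℝ

/-- The vector space `ℝ⁶ = ℝ³ × ℝ³`. -/
abbrev E6 := E3 × E3

/-- The Euclidean product of `ℝ³` for `ε = 1`, the Lorentz-Minkowski product for `ε = -1`. -/
def form (ε : ℝ) (x y : E3) : ℝ := x 0 * y 0 + x 1 * y 1 + ε * (x 2 * y 2)

/-- The surface `M²(ε)`: the unit sphere `S²` of `ℝ³` for `ε = 1`; the hyperbolic plane `H²`, the
upper sheet of `x₁² + x₂² - x₃² = -1`, for `ε = -1`. -/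
def M2 (ε : ℝ) : Set E3 := {x | form ε x x = ε ∧ (ε = -1 → 0 < x 2)}

/-- The (pseudo-)Euclidean product of `ℝ³ × ℝ³`. On tangent vectors of `M²(ε) × M²(ε)` it is the
product Riemannian metric. -/
def prodForm (ε : ℝ) (u v : E6) : ℝ := form ε u.1 v.1 + form ε u.2 v.2

/-- The tangent space `T_p (M²(ε) × M²(ε))`, as a subspace of `ℝ⁶`. -/
def ambientTangent (ε : ℝ) (p : E6) : Submodule ℝ E6 where
  carrier := {v | form ε v.1 p.1 = 0 ∧ form ε v.2 p.2 = 0}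
  add_mem' := by
    rintro a b ⟨h1, h2⟩ ⟨h3, h4⟩
    simp only [form, Set.mem_ofPred_eq, Prod.fst_add, Prod.snd_add, Pi.add_apply] at *
    constructor <;> linarith
  zero_mem' := by simp [form]
  smul_mem' := by
    rintro c a ⟨h1, h2⟩
    simp only [form, Set.mem_ofPred_eq, Prod.smul_fst, Prod.smul_snd, Pi.smul_apply,
      smul_eq_mul] at *
    exact ⟨by linear_combination c * h1, by linear_combination c * h2⟩

/-- The orthogonal projection of `u ∈ ℝ⁶` to `T_p (M²(ε) × M²(ε))`, for `p ∈ M²(ε) × M²(ε)`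
(recall `⟨pⱼ, pⱼ⟩ = ε = 1 / ε`). -/
def ambientProj (ε : ℝ) (p u : E6) : E6 :=
  (u.1 - (ε * form ε u.1 p.1) • p.1, u.2 - (ε * form ε u.2 p.2) • p.2)

/-- The orthogonal projection, with respect to `prodForm ε`, of `u` to the subspace `W`
(`0` if there is none; see `existsUnique_orthProj` for the case in use). -/
def orthProj (ε : ℝ) (W : Submodule ℝ E6) (u : E6) : E6 :=
  open Classical in
  if h : ∃ n, n ∈ W ∧ ∀ m ∈ W, prodForm ε (u - n) m = 0 then h.choose else 0

section Hypersurface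

variable {N : Type*} [TopologicalSpace N] [ChartedSpace (EuclideanSpace ℝ (Fin 3)) N]

/-- `Ψ : N → M²(ε) × M²(ε)` is an immersed hypersurface (`N` is a `3`-manifold): a smooth map into
`ℝ⁶` with values in `M²(ε) × M²(ε)` and with injective differentials. -/
structure IsHypersurface (ε : ℝ) (Ψ : N → E6) : Prop where
  smooth : ContMDiff (𝓡 3) 𝓘(ℝ, E6) ∞ Ψ
  mem : ∀ x, Ψ x ∈ M2 ε ×ˢ M2 ε
  immersion : ∀ x, Function.Injective (mfderiv (𝓡 3) 𝓘(ℝ, E6) Ψ x)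

/-- The differential `dΨ_x (v)`, as a vector of `ℝ⁶`. -/
def differential (Ψ : N → E6) (x : N) (v : TangentSpace (𝓡 3) x) : E6 :=
  mfderiv (𝓡 3) 𝓘(ℝ, E6) Ψ x v

/-- The induced metric on `N`. -/
def inducedMetric (ε : ℝ) (Ψ : N → E6) (x : N) (v w : TangentSpace (𝓡 3) x) : ℝ :=
  prodForm ε (differential Ψ x v) (differential Ψ x w)

/-- The normal space of `Ψ` at `x`, inside `T (M²(ε) × M²(ε))`. -/
def normalSpace (ε : ℝ) (Ψ : N → E6) (x : N) : Submodule ℝ E6 where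
  carrier := {n | n ∈ ambientTangent ε (Ψ x) ∧ ∀ v, prodForm ε n (differential Ψ x v) = 0}
  add_mem' := by
    rintro a b ⟨h1, h2⟩ ⟨h3, h4⟩
    refine ⟨Submodule.add_mem _ h1 h3, fun v => ?_⟩
    have h5 := h2 v
    have h6 := h4 v
    simp only [prodForm, form, Prod.fst_add, Prod.snd_add, Pi.add_apply] at *
    linarith
  zero_mem' := ⟨Submodule.zero_mem _, fun v => by simp [prodForm, form]⟩
  smul_mem' := by
    rintro c a ⟨h1, h2⟩
    refine ⟨Submodule.smul_mem _ c h1, fun v => ?_⟩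
    have h5 := h2 v
    simp only [prodForm, form, Prod.smul_fst, Prod.smul_snd, Pi.smul_apply, smul_eq_mul] at *
    linear_combination c * h5

/-- The flat derivative `D_v (dΨ (W))` at `x`, where `W` is the vector field with constant
coordinates in the preferred chart at `x` that takes the value `w` at `x` (in Mathlib the vectors
of `T_x N` are given by their coordinates in that chart). -/
def flatDerivative (Ψ : N → E6) (x : N) (v w : TangentSpace (𝓡 3) x) : E6 :=
  fderiv ℝ (fderiv ℝ (Ψ ∘ (extChartAt (𝓡 3) x).symm)) (extChartAt (𝓡 3) x x) v w

/-- `∇̄_v (dΨ (W))` at `x`, with `W` as in `flatDerivative`: the Levi-Civita connection of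
`M²(ε) × M²(ε)` is the tangential part of the flat derivative of `ℝ⁶`. -/
def leviCivitaDerivative (ε : ℝ) (Ψ : N → E6) (x : N) (v w : TangentSpace (𝓡 3) x) : E6 :=
  ambientProj ε (Ψ x) (flatDerivative Ψ x v w)

/-- The second fundamental form `σ(v, w) = (∇̄_v (dΨ (W)))^⊥` of `Ψ` in `M²(ε) × M²(ε)`. -/
def secondFundamentalForm (ε : ℝ) (Ψ : N → E6) (x : N) (v w : TangentSpace (𝓡 3) x) : E6 :=
  orthProj ε (normalSpace ε Ψ x) (leviCivitaDerivative ε Ψ x v w)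

/-- The `i`-th vector of the coordinate basis of `T_x N`. -/
def coordVector (x : N) (i : Fin 3) : TangentSpace (𝓡 3) x :=
  (EuclideanSpace.single i (1 : ℝ) : EuclideanSpace ℝ (Fin 3))

/-- The matrix `(g_ij)` of the induced metric in the coordinate basis. -/
def gramMatrix (ε : ℝ) (Ψ : N → E6) (x : N) : Matrix (Fin 3) (Fin 3) ℝ :=
  Matrix.of fun i j => inducedMetric ε Ψ x (coordVector x i) (coordVector x j)

/-- The mean curvature vector: one third of the trace `∑ g^ij σ(∂_i, ∂_j)` of `σ`. -/
def meanCurvatureVector (ε : ℝ) (Ψ : N → E6) (x : N) : E6 :=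
  (1 / 3 : ℝ) • ∑ i, ∑ j, (gramMatrix ε Ψ x)⁻¹ i j •
    secondFundamentalForm ε Ψ x (coordVector x i) (coordVector x j)

/-- `Ψ` is totally umbilical: `σ(v, w) = ⟨v, w⟩ H`. -/
def IsTotallyUmbilical (ε : ℝ) (Ψ : N → E6) : Prop :=
  ∀ (x : N) (v w : TangentSpace (𝓡 3) x),
    secondFundamentalForm ε Ψ x v w = inducedMetric ε Ψ x v w • meanCurvatureVector ε Ψ x

/-- `Ψ` has constant mean curvature: the mean curvature vector has constant length. (The mean
curvature with respect to a unit normal field is that length up to sign; no unit normal field is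
assumed to exist globally.) -/
def HasConstantMeanCurvature (ε : ℝ) (Ψ : N → E6) : Prop :=
  ∃ c : ℝ, ∀ x : N,
    Real.sqrt (prodForm ε (meanCurvatureVector ε Ψ x) (meanCurvatureVector ε Ψ x)) = c

/-- `Ψ` is totally geodesic: `σ = 0`. -/
def IsTotallyGeodesic (ε : ℝ) (Ψ : N → E6) : Prop :=
  ∀ (x : N) (v w : TangentSpace (𝓡 3) x), secondFundamentalForm ε Ψ x v w = 0

/-- The geodesic `t ↦ (cos t, sin t, 0)` of `S²`, respectively `t ↦ (0, sinh t, cosh t)` of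
`H²`. -/
def geodesic (ε : ℝ) (t : ℝ) : E3 :=
  open Classical in
  if ε = 1 then ![Real.cos t, Real.sin t, 0] else ![0, Real.sinh t, Real.cosh t]

/-- The standard embedding `(p, t) ↦ (p, geodesic t)` of `M²(ε) × ℝ`. -/
def standardEmbedding (ε : ℝ) (q : E3 × ℝ) : E6 := (q.1, geodesic ε q.2)

/-- A congruence: a linear isometry of the ambient (pseudo-)Euclidean space `ℝ⁶` that maps
`M²(ε) × M²(ε)` onto itself, so that it restricts to an isometry of `M²(ε) × M²(ε)`. -/
def IsCongruence (ε : ℝ) (L : E6 ≃ₗ[ℝ] E6) : Prop :=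
  (∀ u v, prodForm ε (L u) (L v) = prodForm ε u v) ∧ L '' (M2 ε ×ˢ M2 ε) = M2 ε ×ˢ M2 ε

/-- `Ψ` is locally congruent to the standard embedding of `M²(ε) × ℝ`: every point of `N` has an
open neighbourhood `U` with a diffeomorphism `φ`, with inverse `ψ`, from `U` to an open subset of
`M²(ε) × ℝ`, such that `Ψ` is on `U` the standard embedding after `φ`, up to a congruence `L`. -/
def IsLocallyStandard (ε : ℝ) (Ψ : N → E6) : Prop :=
  ∀ x : N, ∃ (U : Set N) (V : Set (E3 × ℝ)) (φ : N → E3 × ℝ) (ψ : E3 × ℝ → N)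
    (L : E6 ≃ₗ[ℝ] E6),
    IsOpen U ∧ x ∈ U ∧ IsOpen V ∧
    Set.BijOn φ U (V ∩ M2 ε ×ˢ Set.univ) ∧
    ContMDiffOn (𝓡 3) 𝓘(ℝ, E3 × ℝ) ∞ φ U ∧
    Set.LeftInvOn ψ φ U ∧
    ContMDiffOn 𝓘(ℝ, E3 × ℝ) (𝓡 3) ∞ ψ (V ∩ M2 ε ×ˢ Set.univ) ∧
    IsCongruence ε L ∧
    ∀ y ∈ U, Ψ y = L (standardEmbedding ε (φ y))

end Hypersurface

/-- The metric of `M²(ε)` is positive definite. -/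
theorem form_self_pos {ε : ℝ} (hε : ε = 1 ∨ ε = -1) {p v : E3} (hp : p ∈ M2 ε)
    (hv : form ε v p = 0) (h0 : v ≠ 0) : 0 < form ε v v := by
  have hsum : 0 < v 0 ^ 2 + v 1 ^ 2 + v 2 ^ 2 := by
    by_contra hcon
    apply h0
    have h1 := sq_nonneg (v 0)
    have h2 := sq_nonneg (v 1)
    have h3 := sq_nonneg (v 2)
    funext i
    fin_cases i
    · exact pow_eq_zero_iff (two_ne_zero) |>.1 (show v 0 ^ 2 = 0 by linarith)
    · exact pow_eq_zero_iff (two_ne_zero) |>.1 (show v 1 ^ 2 = 0 by linarith)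
    · exact pow_eq_zero_iff (two_ne_zero) |>.1 (show v 2 ^ 2 = 0 by linarith)
  rcases hε with rfl | rfl
  · simp only [form]; nlinarith
  · obtain ⟨h1, h2⟩ := hp
    simp only [form] at *
    have hvp : v 2 * p 2 = v 0 * p 0 + v 1 * p 1 := by linarith
    have hpp : p 2 ^ 2 = 1 + p 0 ^ 2 + p 1 ^ 2 := by linarith
    have key : (v 0 ^ 2 + v 1 ^ 2 - v 2 ^ 2) * p 2 ^ 2
        = v 0 ^ 2 + v 1 ^ 2 + (v 0 * p 1 - v 1 * p 0) ^ 2 := by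
      linear_combination (v 0 ^ 2 + v 1 ^ 2) * hpp
        - (v 2 * p 2 + (v 0 * p 0 + v 1 * p 1)) * hvp
    have hp2 : 0 < p 2 ^ 2 := by nlinarith [sq_nonneg (p 0), sq_nonneg (p 1)]
    by_contra hcon
    have h3 : (v 0 ^ 2 + v 1 ^ 2 - v 2 ^ 2) * p 2 ^ 2 ≤ 0 :=
      mul_nonpos_of_nonpos_of_nonneg (by linarith) hp2.le
    have h4 := sq_nonneg (v 0 * p 1 - v 1 * p 0)
    have h5 : v 0 ^ 2 + v 1 ^ 2 ≤ 0 := by linarith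
    have h6 := sq_nonneg (v 0)
    have h7 := sq_nonneg (v 1)
    have h8 : 0 < v 2 ^ 2 := by linarith
    have h9 : v 0 = 0 := pow_eq_zero_iff two_ne_zero |>.1 (by linarith)
    have h10 : v 1 = 0 := pow_eq_zero_iff two_ne_zero |>.1 (by linarith)
    rw [h9, h10] at hvp
    have : (v 2 * p 2) ^ 2 = 0 := by rw [hvp]; ring
    rw [mul_pow] at this
    have := mul_pos h8 hp2
    linarith

/-- Orthogonal projections to subspaces of `T_p (M²(ε) × M²(ε))` exist and are unique. -/
theorem existsUnique_orthProj {ε : ℝ} (hε : ε = 1 ∨ ε = -1) {p : E6} (hp : p ∈ M2 ε ×ˢ M2 ε)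
    (W : Submodule ℝ E6) (hW : W ≤ ambientTangent ε p) (u : E6) :
    ∃! n, n ∈ W ∧ ∀ m ∈ W, prodForm ε (u - n) m = 0 := by
  have hnn : ∀ (q v : E3), q ∈ M2 ε → form ε v q = 0 → 0 ≤ form ε v v := by
    intro q v hq hv
    by_cases h : v = 0
    · simp [h, form]
    · exact (form_self_pos hε hq hv h).le
  have hdef : ∀ v ∈ W, prodForm ε v v = 0 → v = 0 := by
    intro v hv h
    obtain ⟨h1, h2⟩ := hW hv
    have h3 := hnn _ _ hp.1 h1
    have h4 := hnn _ _ hp.2 h2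
    unfold prodForm at h
    refine Prod.ext ?_ ?_
    · by_contra hne
      have := form_self_pos hε hp.1 h1 hne
      linarith
    · by_contra hne
      have := form_self_pos hε hp.2 h2 hne
      linarith
  let B : E6 →ₗ[ℝ] E6 →ₗ[ℝ] ℝ := LinearMap.mk₂ ℝ (prodForm ε)
    (by intros; simp [prodForm, form]; ring) (by intros; simp [prodForm, form]; ring)
    (by intros; simp [prodForm, form]; ring) (by intros; simp [prodForm, form]; ring)
  let T : W →ₗ[ℝ] Module.Dual ℝ W := (B.domRestrict₁₂ W W)
  have hT : Function.Injective T := by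
    rw [← LinearMap.ker_eq_bot, LinearMap.ker_eq_bot']
    intro m hm
    have := congrArg (fun f => f m) hm
    exact Subtype.ext (hdef m m.2 this)
  have hTs : Function.Surjective T :=
    (LinearMap.injective_iff_surjective_of_finrank_eq_finrank
      (Subspace.dual_finrank_eq (K := ℝ) (V := W)).symm).1 hT
  obtain ⟨n, hn⟩ := hTs ((B u).domRestrict W)
  have hsub : ∀ a b m : E6, prodForm ε (a - b) m = prodForm ε a m - prodForm ε b m := by
    intros; simp [prodForm, form]; ring
  refine ⟨n, ⟨n.2, fun m hm => ?_⟩, ?_⟩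
  · have := congrArg (fun f => f ⟨m, hm⟩) hn
    have h2 : prodForm ε n m = prodForm ε u m := this
    rw [hsub, h2, sub_self]
  · rintro k ⟨hk, hk2⟩
    have h1 : (⟨k, hk⟩ : W) = n := by
      apply hT
      rw [hn]
      ext ⟨m, hm⟩
      have := hk2 m hm
      rw [hsub] at this
      change prodForm ε k m = prodForm ε u m
      linarith
    rw [← h1]

end ProductSurfaces

end

/-! Everything is read off from the flat derivative in `ℝ⁶` of a local unit normal field `n = (n₁,
n₂)` of `f = (f₁, f₂)`, the map `Ψ` in a chart. Umbilicity gives `⟨dn(v), df(w)⟩ = -l ⟨df(v),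
df(w)⟩` with `l = ⟨n, H⟩`. Since `l² = |H|²` is constant and `l` is continuous, `l` is constant on a
connected patch (`IsHypersurface.exists_isUmbilicalPatch`).

Put `α(v) = ⟨n₁, df₁(v)⟩`. The components of `dn` along the position vectors follow from tangency of
`n`, so `dn(v) = -l df(v) - ε α(v) (f₁, -f₂)`. As `l` is constant, symmetry of the second
derivatives of `f` and `n` yields `α(v) df(w) = α(w) df(v)` (`IsUmbilicalPatch.codazzi`). A linear
form on a `3`-dimensional space has a nonzero kernel, and `df` is injective, so `α = 0`. Then `(n₁,
0)` is normal too, hence a multiple of `n`, and one of `n₁`, `n₂` vanishes. Differentiating `α = 0`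
now forces `l = 0` (`IsUmbilicalPatch.shape_eq_zero`): this is total geodesy.

With `α = l = 0` also `dn = 0`, so `n` is a constant vector `(0, ν)` or `(ν, 0)`. One factor of `f`
thus stays in the geodesic `ν^⊥ ∩ M²(ε)`. The other factor and the arc length along this geodesic
are local coordinates (`exists_standard_chart`), and an isometry of one factor, followed by a swap
if needed, gives the standard form. -/

namespace ProductSurfaces

/-! ### Linear algebra of the two forms and of normal vectors -/

section Algebra

variable {ε : ℝ}

lemma ne_zero_of_eq_one_or (hε : ε = 1 ∨ ε = -1) : ε ≠ 0 := by
  rcases hε with rfl | rfl <;> norm_num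

lemma mul_self_of_eq_one_or (hε : ε = 1 ∨ ε = -1) : ε * ε = 1 := by
  rcases hε with rfl | rfl <;> norm_num

lemma form_comm (x y : E3) : form ε x y = form ε y x := by
  simp only [form]; ring

@[simp] lemma form_add_left (x y z : E3) : form ε (x + y) z = form ε x z + form ε y z := by
  simp only [form, Pi.add_apply]; ring

@[simp] lemma form_add_right (x y z : E3) : form ε z (x + y) = form ε z x + form ε z y := by
  simp only [form, Pi.add_apply]; ring

@[simp] lemma form_sub_left (x y z : E3) : form ε (x - y) z = form ε x z - form ε y z := by
  simp only [form, Pi.sub_apply]; ring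

@[simp] lemma form_smul_left (c : ℝ) (x z : E3) : form ε (c • x) z = c * form ε x z := by
  simp only [form, Pi.smul_apply, smul_eq_mul]; ring

@[simp] lemma form_smul_right (c : ℝ) (x z : E3) : form ε z (c • x) = c * form ε z x := by
  simp only [form, Pi.smul_apply, smul_eq_mul]; ring

@[simp] lemma form_neg_left (x z : E3) : form ε (-x) z = -form ε x z := by
  simp only [form, Pi.neg_apply]; ring

@[simp] lemma form_sub_right (x y z : E3) : form ε z (x - y) = form ε z x - form ε z y := by
  simp only [form, Pi.sub_apply]; ring

@[simp] lemma form_neg_right (x z : E3) : form ε z (-x) = -form ε z x := by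
  simp only [form, Pi.neg_apply]; ring

@[simp] lemma form_zero_left (x : E3) : form ε 0 x = 0 := by simp [form]

@[simp] lemma form_zero_right (x : E3) : form ε x 0 = 0 := by simp [form]

lemma prodForm_comm (u v : E6) : prodForm ε u v = prodForm ε v u := by
  simp only [prodForm, form_comm u.1, form_comm u.2]

@[simp] lemma prodForm_add_left (x y z : E6) :
    prodForm ε (x + y) z = prodForm ε x z + prodForm ε y z := by
  simp only [prodForm, Prod.fst_add, Prod.snd_add, form_add_left]; ring

@[simp] lemma prodForm_add_right (x y z : E6) :
    prodForm ε z (x + y) = prodForm ε z x + prodForm ε z y := by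
  simp only [prodForm, Prod.fst_add, Prod.snd_add, form_add_right]; ring

@[simp] lemma prodForm_sub_left (x y z : E6) :
    prodForm ε (x - y) z = prodForm ε x z - prodForm ε y z := by
  simp only [prodForm, Prod.fst_sub, Prod.snd_sub, form_sub_left]; ring

@[simp] lemma prodForm_smul_left (c : ℝ) (x z : E6) :
    prodForm ε (c • x) z = c * prodForm ε x z := by
  simp only [prodForm, Prod.smul_fst, Prod.smul_snd, form_smul_left]; ring

@[simp] lemma prodForm_smul_right (c : ℝ) (x z : E6) :
    prodForm ε z (c • x) = c * prodForm ε z x := by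
  simp only [prodForm, Prod.smul_fst, Prod.smul_snd, form_smul_right]; ring

@[simp] lemma prodForm_zero_left (x : E6) : prodForm ε 0 x = 0 := by simp [prodForm]

@[simp] lemma prodForm_zero_right (x : E6) : prodForm ε x 0 = 0 := by simp [prodForm]

/-- `form ε` as a continuous bilinear map. -/
noncomputable def formL (ε : ℝ) : E3 →L[ℝ] E3 →L[ℝ] ℝ :=
  (LinearMap.mk₂ ℝ (form ε) (by intros; simp) (by intros; simp) (by intros; simp)
    (by intros; simp)).toContinuousBilinearMap

/-- `prodForm ε` as a continuous bilinear map. -/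
noncomputable def prodFormL (ε : ℝ) : E6 →L[ℝ] E6 →L[ℝ] ℝ :=
  (LinearMap.mk₂ ℝ (prodForm ε) (by intros; simp) (by intros; simp) (by intros; simp)
    (by intros; simp)).toContinuousBilinearMap

lemma formL_apply (x y : E3) : formL ε x y = form ε x y := rfl

lemma prodFormL_apply (u v : E6) : prodFormL ε u v = prodForm ε u v := rfl

lemma eq_zero_of_forall_form (hε : ε ≠ 0) {x : E3} (h : ∀ y, form ε x y = 0) : x = 0 := by
  funext i
  have := h (Pi.single i 1)
  fin_cases i <;> simpa [form, hε] using this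

lemma eq_zero_of_forall_prodForm (hε : ε ≠ 0) {u : E6} (h : ∀ v, prodForm ε u v = 0) :
    u = 0 := by
  refine Prod.ext (eq_zero_of_forall_form hε fun y => ?_) (eq_zero_of_forall_form hε fun y => ?_)
  · simpa [prodForm] using h (y, 0)
  · simpa [prodForm] using h (0, y)

lemma form_self_nonneg (hε : ε = 1 ∨ ε = -1) {p v : E3} (hp : p ∈ M2 ε) (hv : form ε v p = 0) :
    0 ≤ form ε v v := by
  by_cases h : v = 0
  · simp [h]
  · exact (form_self_pos hε hp hv h).le

lemma prodForm_self_pos (hε : ε = 1 ∨ ε = -1) {p v : E6} (hp : p ∈ M2 ε ×ˢ M2 ε)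
    (hv : v ∈ ambientTangent ε p) (h0 : v ≠ 0) : 0 < prodForm ε v v := by
  by_cases h1 : v.1 = 0
  · have h2 : v.2 ≠ 0 := fun h2 => h0 (Prod.ext h1 h2)
    exact add_pos_of_nonneg_of_pos (form_self_nonneg hε hp.1 hv.1) (form_self_pos hε hp.2 hv.2 h2)
  · exact add_pos_of_pos_of_nonneg (form_self_pos hε hp.1 hv.1 h1) (form_self_nonneg hε hp.2 hv.2)

variable {V : Type*} [NormedAddCommGroup V] [NormedSpace ℝ V]

/-- `A` embeds `V` in `T_p (M²(ε) × M²(ε))`. -/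
structure IsTangentEmbedding (ε : ℝ) (p : E6) (A : V →L[ℝ] E6) : Prop where
  mem : p ∈ M2 ε ×ˢ M2 ε
  injective : Function.Injective A
  tangent : ∀ v, A v ∈ ambientTangent ε p

/-- `n` is a nonzero normal vector, in `T_p (M²(ε) × M²(ε))`, of the image of `A`. -/
structure IsNormalVector (ε : ℝ) (p : E6) (A : V →L[ℝ] E6) (n : E6) : Prop where
  tangent : n ∈ ambientTangent ε p
  orthogonal : ∀ v, prodForm ε n (A v) = 0
  ne_zero : n ≠ 0

variable {p n : E6} {A : V →L[ℝ] E6}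

/-- The four kinds of summands are independent and `3 + 1 + 1 + 1 = 6`. -/
lemma IsTangentEmbedding.exists_decomposition (hε : ε = 1 ∨ ε = -1)
    (hV : Module.finrank ℝ V = 3) (hA : IsTangentEmbedding ε p A) (hn : IsNormalVector ε p A n)
    (m : E6) : ∃ (v : V) (a b c : ℝ), m = A v + a • n + (b • p.1, c • p.2) := by
  have : FiniteDimensional ℝ V := .of_finrank_pos (by omega)
  have hε0 := ne_zero_of_eq_one_or hε
  let S : V × ℝ × ℝ × ℝ →ₗ[ℝ] E6 :=
    { toFun := fun w => A w.1 + w.2.1 • n + (w.2.2.1 • p.1, w.2.2.2 • p.2)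
      map_add' := by
        intro x y
        refine Prod.ext ?_ ?_ <;> simp <;> module
      map_smul' := by
        intro c x
        refine Prod.ext ?_ ?_ <;> simp <;> module }
  have hS : Function.Injective S := by
    rw [← LinearMap.ker_eq_bot, LinearMap.ker_eq_bot']
    rintro ⟨v, a, b, c⟩ h
    have h : A v + a • n + (b • p.1, c • p.2) = 0 := h
    have hp1 : form ε p.1 p.1 = ε := hA.mem.1.1
    have hp2 : form ε p.2 p.2 = ε := hA.mem.2.1
    have hv := hA.tangent v
    -- Pairing with the two position vectors and with `n` isolates `b`, `c` and `a` in turn.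
    have hb : b = 0 := by
      have := congrArg (fun u : E6 => form ε u.1 p.1) h
      simpa [hv.1, hn.tangent.1, hp1, hε0] using this
    have hc : c = 0 := by
      have := congrArg (fun u : E6 => form ε u.2 p.2) h
      simpa [hv.2, hn.tangent.2, hp2, hε0] using this
    have ha : a = 0 := by
      have := congrArg (fun u : E6 => prodForm ε n u) h
      simpa [hb, hc, hn.orthogonal v, (prodForm_self_pos hε hA.mem hn.tangent hn.ne_zero).ne',
        ← Prod.zero_eq_mk] using this
    have h0 : A v = A 0 := by simpa [ha, hb, hc, ← Prod.zero_eq_mk] using h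
    simp [hA.injective h0, ha, hb, hc]
  have hfr : Module.finrank ℝ (V × ℝ × ℝ × ℝ) = Module.finrank ℝ E6 := by simp [hV]
  obtain ⟨⟨v, a, b, c⟩, h⟩ :=
    (LinearMap.injective_iff_surjective_of_finrank_eq_finrank hfr).1 hS m
  exact ⟨v, a, b, c, h.symm⟩

/-- Tangency supplies orthogonality to the position vectors, so `m` is orthogonal to all of `ℝ⁶`,
where the form is nondegenerate even if indefinite. -/
lemma IsTangentEmbedding.eq_zero_of_orthogonal (hε : ε = 1 ∨ ε = -1)
    (hV : Module.finrank ℝ V = 3) (hA : IsTangentEmbedding ε p A) (hn : IsNormalVector ε p A n)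
    {m : E6} (h1 : ∀ v, prodForm ε m (A v) = 0) (h2 : prodForm ε m n = 0)
    (h3 : m ∈ ambientTangent ε p) : m = 0 := by
  refine eq_zero_of_forall_prodForm (ne_zero_of_eq_one_or hε) fun u => ?_
  obtain ⟨v, a, b, c, rfl⟩ := hA.exists_decomposition hε hV hn u
  rw [prodForm_add_right, prodForm_add_right, h1, prodForm_smul_right, h2]
  simp [prodForm, h3.1, h3.2]

lemma IsTangentEmbedding.eq_smul_normal (hε : ε = 1 ∨ ε = -1)
    (hV : Module.finrank ℝ V = 3) (hA : IsTangentEmbedding ε p A) (hn : IsNormalVector ε p A n)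
    (hunit : prodForm ε n n = 1)
    {m : E6} (h1 : ∀ v, prodForm ε m (A v) = 0) (h3 : m ∈ ambientTangent ε p) :
    m = prodForm ε m n • n := by
  rw [← sub_eq_zero]
  refine hA.eq_zero_of_orthogonal hε hV hn (fun v => ?_) ?_ ?_
  · simp [h1, hn.orthogonal]
  · simp [hunit]
  · exact Submodule.sub_mem _ h3 (Submodule.smul_mem _ _ hn.tangent)

/-- Five homogeneous linear equations in six unknowns: three from a basis of `V`, two from tangency.
-/
lemma exists_isNormalVector (hV : Module.finrank ℝ V = 3) (p : E6) (A : V →L[ℝ] E6) :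
    ∃ n, IsNormalVector ε p A n := by
  have : FiniteDimensional ℝ V := .of_finrank_pos (by omega)
  let b := Module.finBasisOfFinrankEq ℝ V hV
  let T : E6 →ₗ[ℝ] (Fin 3 → ℝ) × ℝ × ℝ :=
    { toFun := fun m => (fun i => prodForm ε m (A (b i)), form ε m.1 p.1, form ε m.2 p.2)
      map_add' := by intro x y; ext <;> simp
      map_smul' := by intro c x; ext <;> simp }
  have hT : T.ker ≠ ⊥ := LinearMap.ker_ne_bot_of_finrank_lt (by simp)
  obtain ⟨n, hn, hn0⟩ := Submodule.exists_mem_ne_zero_of_ne_bot hT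
  have hn' : T n = 0 := hn
  simp only [T, LinearMap.coe_mk, AddHom.coe_mk, Prod.mk_eq_zero] at hn'
  refine ⟨n, ⟨hn'.2.1, hn'.2.2⟩, fun v => ?_, hn0⟩
  have hb : (prodFormL ε n).toLinearMap ∘ₗ A.toLinearMap = 0 :=
    b.ext fun i => congrFun hn'.1 i
  exact LinearMap.congr_fun hb v

end Algebra

/-! ### Umbilical patches: the Codazzi argument -/

section Patch

variable {ε : ℝ} {V : Type*} [NormedAddCommGroup V] [NormedSpace ℝ V]

lemma one_add_one_le_infty : (1 + 1 : ℕ∞ω) ≤ ∞ := by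
  change ((1 + 1 : ℕ∞) : ℕ∞ω) ≤ ((⊤ : ℕ∞) : ℕ∞ω)
  exact WithTop.coe_le_coe.2 le_top

lemma form_fderiv_eq_zero {x y : V → E3} {x' y' : V →L[ℝ] E3} {u : V} {c : ℝ}
    (hx : HasFDerivAt x x' u) (hy : HasFDerivAt y y' u)
    (h : ∀ᶠ z in nhds u, form ε (x z) (y z) = c) (v : V) :
    form ε (x' v) (y u) + form ε (x u) (y' v) = 0 := by
  have h1 := (formL ε).hasFDerivAt_of_bilinear hx hy
  have h2 : HasFDerivAt (fun z => formL ε (x z) (y z)) (0 : V →L[ℝ] ℝ) u :=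
    (hasFDerivAt_const c u).congr_of_eventuallyEq h
  have := DFunLike.congr_fun (h1.unique h2) v
  simpa [formL_apply, add_comm] using this

lemma prodForm_fderiv_eq_zero {x y : V → E6} {x' y' : V →L[ℝ] E6} {u : V} {c : ℝ}
    (hx : HasFDerivAt x x' u) (hy : HasFDerivAt y y' u)
    (h : ∀ᶠ z in nhds u, prodForm ε (x z) (y z) = c) (v : V) :
    prodForm ε (x' v) (y u) + prodForm ε (x u) (y' v) = 0 := by
  have h1 := (prodFormL ε).hasFDerivAt_of_bilinear hx hy
  have h2 : HasFDerivAt (fun z => prodFormL ε (x z) (y z)) (0 : V →L[ℝ] ℝ) u :=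
    (hasFDerivAt_const c u).congr_of_eventuallyEq h
  have := DFunLike.congr_fun (h1.unique h2) v
  simpa [prodFormL_apply, add_comm] using this

lemma exists_ne_zero_form_eq_zero (ε : ℝ) (p q : E3) :
    ∃ e, (form ε e p = 0 ∧ form ε e q = 0) ∧ e ≠ 0 := by
  let T : E3 →ₗ[ℝ] ℝ × ℝ := ((formL ε).flip p).toLinearMap.prod ((formL ε).flip q).toLinearMap
  obtain ⟨e, he, he0⟩ := Submodule.exists_mem_ne_zero_of_ne_bot
    (LinearMap.ker_ne_bot_of_finrank_lt (f := T) (by simp))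
  exact ⟨e, Prod.mk_eq_zero.1 (LinearMap.mem_ker.1 he), he0⟩

/-- A parametrized piece of a totally umbilical hypersurface of `M²(ε) × M²(ε)` with unit normal
field `n` and shape operator `l • id` for a constant `l`. -/
structure IsUmbilicalPatch (ε l : ℝ) (B : Set V) (f n : V → E6) : Prop where
  isOpen : IsOpen B
  isPreconnected : IsPreconnected B
  smooth : ContDiffOn ℝ ∞ f B
  smooth_normal : ContDiffOn ℝ ∞ n B
  embedding : ∀ u ∈ B, IsTangentEmbedding ε (f u) (fderiv ℝ f u)
  normal : ∀ u ∈ B, IsNormalVector ε (f u) (fderiv ℝ f u) (n u)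
  unit : ∀ u ∈ B, prodForm ε (n u) (n u) = 1
  weingarten : ∀ u ∈ B, ∀ v w, prodForm ε (fderiv ℝ n u v) (fderiv ℝ f u w)
    = -l * prodForm ε (fderiv ℝ f u v) (fderiv ℝ f u w)

namespace IsUmbilicalPatch

variable {l : ℝ} {B : Set V} {f n : V → E6} (h : IsUmbilicalPatch ε l B f n) {u : V}

include h

lemma contDiffAt (hu : u ∈ B) : ContDiffAt ℝ ∞ f u := h.smooth.contDiffAt (h.isOpen.mem_nhds hu)

lemma contDiffAt_normal (hu : u ∈ B) : ContDiffAt ℝ ∞ n u :=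
  h.smooth_normal.contDiffAt (h.isOpen.mem_nhds hu)

lemma hasFDerivAt (hu : u ∈ B) : HasFDerivAt f (fderiv ℝ f u) u :=
  ((h.contDiffAt hu).differentiableAt (by simp)).hasFDerivAt

lemma hasFDerivAt_normal (hu : u ∈ B) : HasFDerivAt n (fderiv ℝ n u) u :=
  ((h.contDiffAt_normal hu).differentiableAt (by simp)).hasFDerivAt

lemma eventually {P : V → Prop} (hP : ∀ z ∈ B, P z) (hu : u ∈ B) : ∀ᶠ z in nhds u, P z :=
  Filter.eventually_of_mem (h.isOpen.mem_nhds hu) hP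

lemma form_normal_snd (hu : u ∈ B) (v : V) :
    form ε (n u).2 (fderiv ℝ f u v).2 = -form ε (n u).1 (fderiv ℝ f u v).1 := by
  have := (h.normal u hu).orthogonal v
  unfold prodForm at this
  linarith

/-- The derivative of the normal field. The form `v ↦ ⟨n₁, df₁ (v)⟩` is dual to half the tangential
part of the image of `n` under the product structure. -/
lemma fderiv_normal (hε : ε = 1 ∨ ε = -1) (hV : Module.finrank ℝ V = 3) (hu : u ∈ B) (v : V) :
    fderiv ℝ n u v = -l • fderiv ℝ f u v
      - (ε * form ε (n u).1 (fderiv ℝ f u v).1) • ((f u).1, -(f u).2) := by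
  have hee := mul_self_of_eq_one_or hε
  have hf := h.hasFDerivAt hu
  have hn := h.hasFDerivAt_normal hu
  have hp1 : form ε (f u).1 (f u).1 = ε := (h.embedding u hu).mem.1.1
  have hp2 : form ε (f u).2 (f u).2 = ε := (h.embedding u hu).mem.2.1
  have hunit := prodForm_fderiv_eq_zero hn hn (h.eventually h.unit hu) v
  have hn1 := form_fderiv_eq_zero (ε := ε) (c := 0) hn.fst hf.fst
    (h.eventually (fun z hz => (h.normal z hz).tangent.1) hu) v
  have hn2 := form_fderiv_eq_zero (ε := ε) (c := 0) hn.snd hf.snd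
    (h.eventually (fun z hz => (h.normal z hz).tangent.2) hu) v
  simp only [ContinuousLinearMap.coe_comp, Function.comp_apply, ContinuousLinearMap.coe_fst',
    ContinuousLinearMap.coe_snd'] at hn1 hn2
  have ht := (h.embedding u hu).tangent
  have hnt := (h.normal u hu).tangent
  have hsnd := h.form_normal_snd hu v
  rw [← sub_eq_zero]
  -- The difference of the two sides is orthogonal to the image of `df` by the Weingarten equation,
  -- and to `n` because `n` is unit. It is tangent by differentiating `⟨nⱼ, fⱼ⟩ = 0`; the opposite
  -- signs come from `⟨n₂, df₂(v)⟩ = -⟨n₁, df₁(v)⟩`.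
  refine (h.embedding u hu).eq_zero_of_orthogonal hε hV (h.normal u hu) (fun w => ?_) ?_ ⟨?_, ?_⟩
  · have h1 := (ht w).1
    have h2 := (ht w).2
    rw [form_comm] at h1 h2
    have h3 : prodForm ε ((f u).1, -(f u).2) (fderiv ℝ f u w) = 0 := by simp [prodForm, h1, h2]
    simp only [prodForm_sub_left, prodForm_smul_left, h3, h.weingarten u hu]
    ring
  · have h1 := hnt.1
    have h2 := hnt.2
    have h3 := (h.normal u hu).orthogonal v
    rw [form_comm] at h1 h2
    rw [prodForm_comm] at h3
    rw [prodForm_comm (n u)] at hunit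
    have : prodForm ε ((f u).1, -(f u).2) (n u) = 0 := by simp [prodForm, h1, h2]
    simp only [prodForm_sub_left, prodForm_smul_left, this, h3]
    linarith
  · have := (ht v).1
    simp [this, hp1]
    linear_combination hn1 + form ε (n u).1 (fderiv ℝ f u v).1 * hee
  · have := (ht v).2
    simp [this, hp2]
    linear_combination hn2 - form ε (n u).1 (fderiv ℝ f u v).1 * hee - hsnd

/-- Symmetry of the second derivative of `n`, applied to the formula for `dn`. As `l` is constant,
the second derivatives of `f` cancel. -/
lemma codazzi (hε : ε = 1 ∨ ε = -1) (hV : Module.finrank ℝ V = 3) (hu : u ∈ B) (v w : V) :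
    form ε (n u).1 (fderiv ℝ f u v).1 • fderiv ℝ f u w
      = form ε (n u).1 (fderiv ℝ f u w).1 • fderiv ℝ f u v := by
  have hε0 := ne_zero_of_eq_one_or hε
  have hp1 : form ε (f u).1 (f u).1 = ε := (h.embedding u hu).mem.1.1
  have hp2 : form ε (f u).2 (f u).2 = ε := (h.embedding u hu).mem.2.1
  have h2 : HasFDerivAt (fderiv ℝ f) (fderiv ℝ (fderiv ℝ f) u) u :=
    (((h.contDiffAt hu).fderiv_right (m := 1)
      one_add_one_le_infty).differentiableAt (by simp)).hasFDerivAt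
  have hn2 : HasFDerivAt (fderiv ℝ n) (fderiv ℝ (fderiv ℝ n) u) u :=
    (((h.contDiffAt_normal hu).fderiv_right (m := 1)
      one_add_one_le_infty).differentiableAt
      (by simp)).hasFDerivAt
  have hsf : IsSymmSndFDerivAt ℝ f u := (h.contDiffAt hu).isSymmSndFDerivAt
    (by simpa [one_add_one_eq_two] using one_add_one_le_infty)
  have hsn : IsSymmSndFDerivAt ℝ n u := (h.contDiffAt_normal hu).isSymmSndFDerivAt
    (by simpa [one_add_one_eq_two] using one_add_one_le_infty)
  have hf := h.hasFDerivAt hu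
  have hn := h.hasFDerivAt_normal hu
  -- Here `c` collects the derivative of the coefficient of `(f₁, -f₂)`. Its value is irrelevant.
  have key : ∀ v w, ∃ c : ℝ, fderiv ℝ (fderiv ℝ n) u w v = -l • fderiv ℝ (fderiv ℝ f) u w v
      - ((ε * form ε (n u).1 (fderiv ℝ f u v).1) • ((fderiv ℝ f u w).1, -(fderiv ℝ f u w).2)
        + c • ((f u).1, -(f u).2)) := by
    intro v w
    have ha := ((formL ε).hasFDerivAt_of_bilinear hn.fst
      ((h2.clm_apply (hasFDerivAt_const v u)).fst)).const_mul ε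
    have hp := hf.fst.prodMk hf.snd.neg
    have h3 := ((h2.clm_apply (hasFDerivAt_const v u)).const_smul (-l)).sub (ha.smul hp)
    have h4 := (hn2.clm_apply (hasFDerivAt_const v u)).unique (h3.congr_of_eventuallyEq
      (h.eventually (fun z hz => h.fderiv_normal hε hV hz v) hu))
    have h5 := DFunLike.congr_fun h4 w
    refine ⟨ε * (form ε (n u).1 (fderiv ℝ (fderiv ℝ f) u w v).1
      + form ε (fderiv ℝ n u w).1 (fderiv ℝ f u v).1), ?_⟩
    refine Eq.trans (by simp) (h5.trans ?_)
    refine Prod.ext ?_ ?_ <;> simp [formL_apply] <;> module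
  obtain ⟨c, hc⟩ := key v w
  obtain ⟨d, hd⟩ := key w v
  have h5 := hsn w v
  rw [hc, hd, hsf w v] at h5
  have h6 : (ε * form ε (n u).1 (fderiv ℝ f u v).1) • ((fderiv ℝ f u w).1, -(fderiv ℝ f u w).2)
        + c • ((f u).1, -(f u).2) = 
      (ε * form ε (n u).1 (fderiv ℝ f u w).1) • ((fderiv ℝ f u v).1, -(fderiv ℝ f u v).2)
        + d • ((f u).1, -(f u).2) := sub_right_injective h5
  -- Pairing with `f₁` kills the tangential terms, leaving `c = d`; the position terms then cancel.
  have h7 := congrArg (fun x : E6 => form ε x.1 (f u).1) h6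
  have ht := (h.embedding u hu).tangent
  have hcd : c = d := by simpa [(ht v).1, (ht w).1, hp1, hε0] using h7
  rw [hcd, add_left_inj, mul_smul, mul_smul] at h6
  have h8 := smul_right_injective _ hε0 h6
  have h9 := congrArg Prod.fst h8
  have h10 := congrArg Prod.snd h8
  refine Prod.ext h9 (neg_injective ?_)
  simpa using h10

/-- If `α(v) ≠ 0`, take `w ≠ 0` in the kernel of `α`. The Codazzi identity becomes `α(v) df(w) = 0`,
against injectivity of `df`. -/
lemma form_normal_fst (hε : ε = 1 ∨ ε = -1) (hV : Module.finrank ℝ V = 3) (hu : u ∈ B) (v : V) :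
    form ε (n u).1 (fderiv ℝ f u v).1 = 0 := by
  have : FiniteDimensional ℝ V := .of_finrank_pos (by omega)
  by_contra hv
  let α : V →ₗ[ℝ] ℝ :=
    (formL ε (n u).1).toLinearMap ∘ₗ LinearMap.fst ℝ E3 E3 ∘ₗ (fderiv ℝ f u).toLinearMap
  have hα : α.ker ≠ ⊥ := LinearMap.ker_ne_bot_of_finrank_lt (by simp [hV])
  obtain ⟨w, hw, hw0⟩ := Submodule.exists_mem_ne_zero_of_ne_bot hα
  have hw : form ε (n u).1 (fderiv ℝ f u w).1 = 0 := hw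
  have h1 := h.codazzi hε hV hu v w
  rw [hw, zero_smul, smul_eq_zero, or_iff_right hv] at h1
  exact hw0 ((h.embedding u hu).injective (by simpa using h1))

lemma fderiv_normal_eq (hε : ε = 1 ∨ ε = -1) (hV : Module.finrank ℝ V = 3) (hu : u ∈ B) :
    fderiv ℝ n u = -l • fderiv ℝ f u := by
  ext1 v
  rw [h.fderiv_normal hε hV hu, h.form_normal_fst hε hV hu]
  simp

/-- Since `α = 0`, the vector `(n₁, 0)` is again normal, hence a multiple of `n`; comparing second
components decides. -/
lemma normal_fst_or_snd_eq_zero (hε : ε = 1 ∨ ε = -1) (hV : Module.finrank ℝ V = 3)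
    (hu : u ∈ B) : (n u).1 = 0 ∨ (n u).2 = 0 := by
  by_contra! hne
  have hn := h.normal u hu
  have h1 : ((n u).1, (0 : E3)) = prodForm ε ((n u).1, (0 : E3)) (n u) • n u := by
    refine (h.embedding u hu).eq_smul_normal hε hV hn (h.unit u hu) (fun v => ?_) ?_
    · simp [prodForm, h.form_normal_fst hε hV hu]
    · exact ⟨hn.tangent.1, by simp⟩
  have h2 := congrArg Prod.snd h1
  rw [Prod.smul_snd, eq_comm, smul_eq_zero, or_iff_left hne.2] at h2
  rw [h2, zero_smul] at h1
  exact hne.1 (congrArg Prod.fst h1)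

/-- Differentiate `⟨n₁, df₁(v)⟩ = 0` in the direction `v`. Where `n₁ = 0`, only the term with `dn₁ =
-l df₁` survives. -/
lemma mul_form_fderiv_fst_of_normal_fst_eq_zero (hε : ε = 1 ∨ ε = -1)
    (hV : Module.finrank ℝ V = 3) (hu : u ∈ B) (h0 : (n u).1 = 0) (v : V) :
    l * form ε (fderiv ℝ f u v).1 (fderiv ℝ f u v).1 = 0 := by
  have h2 : HasFDerivAt (fderiv ℝ f) (fderiv ℝ (fderiv ℝ f) u) u :=
    (((h.contDiffAt hu).fderiv_right (m := 1)
      one_add_one_le_infty).differentiableAt (by simp)).hasFDerivAt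
  have h3 := form_fderiv_eq_zero (ε := ε) (h.hasFDerivAt_normal hu).fst
    (h2.clm_apply (hasFDerivAt_const v u)).fst
    (h.eventually (fun z hz => h.form_normal_fst hε hV hz v) hu) v
  simpa [h0, h.fderiv_normal_eq hε hV hu] using h3

lemma mul_form_fderiv_snd_of_normal_snd_eq_zero (hε : ε = 1 ∨ ε = -1)
    (hV : Module.finrank ℝ V = 3) (hu : u ∈ B) (h0 : (n u).2 = 0) (v : V) :
    l * form ε (fderiv ℝ f u v).2 (fderiv ℝ f u v).2 = 0 := by
  have h2 : HasFDerivAt (fderiv ℝ f) (fderiv ℝ (fderiv ℝ f) u) u :=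
    (((h.contDiffAt hu).fderiv_right (m := 1)
      one_add_one_le_infty).differentiableAt (by simp)).hasFDerivAt
  have h3 := form_fderiv_eq_zero (ε := ε) (c := 0) (h.hasFDerivAt_normal hu).snd
    (h2.clm_apply (hasFDerivAt_const v u)).snd
    (h.eventually (fun z hz => by
      have := h.form_normal_snd hz v
      rwa [h.form_normal_fst hε hV hz, neg_zero] at this) hu) v
  simpa [h0, h.fderiv_normal_eq hε hV hu] using h3

/-- If `l ≠ 0` and `n₁ = 0`, then `df₁ = 0` by definiteness on tangent vectors. Any tangent vector
`(e, 0)` is then orthogonal to both the image of `df` and `n`, which leaves no room for `e ≠ 0`. The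
case `n₂ = 0` is symmetric. -/
lemma shape_eq_zero (hε : ε = 1 ∨ ε = -1) (hV : Module.finrank ℝ V = 3) (hu : u ∈ B) :
    l = 0 := by
  by_contra hl
  have hA := h.embedding u hu
  have hn := h.normal u hu
  rcases h.normal_fst_or_snd_eq_zero hε hV hu with h0 | h0
  -- Only tangency at `f₁` is needed; the second vector `0` imposes nothing.
  · obtain ⟨e, he, he0⟩ := exists_ne_zero_form_eq_zero ε (f u).1 0
    have hd : ∀ v, (fderiv ℝ f u v).1 = 0 := fun v => by
      by_contra hne
      have h1 := form_self_pos hε hA.mem.1 (hA.tangent v).1 hne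
      have h2 := h.mul_form_fderiv_fst_of_normal_fst_eq_zero hε hV hu h0 v
      exact (mul_ne_zero hl h1.ne') h2
    have h1 : ((e, 0) : E6) = 0 := hA.eq_zero_of_orthogonal hε hV hn
      (fun v => by simp [prodForm, hd]) (by simp [prodForm, h0]) ⟨he.1, by simp⟩
    exact he0 (congrArg Prod.fst h1)
  · obtain ⟨e, he, he0⟩ := exists_ne_zero_form_eq_zero ε (f u).2 0
    have hd : ∀ v, (fderiv ℝ f u v).2 = 0 := fun v => by
      by_contra hne
      have h1 := form_self_pos hε hA.mem.2 (hA.tangent v).2 hne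
      have h2 := h.mul_form_fderiv_snd_of_normal_snd_eq_zero hε hV hu h0 v
      exact (mul_ne_zero hl h1.ne') h2
    have h1 : ((0, e) : E6) = 0 := hA.eq_zero_of_orthogonal hε hV hn
      (fun v => by simp [prodForm, hd]) (by simp [prodForm, h0]) ⟨by simp, he.1⟩
    exact he0 (congrArg Prod.snd h1)

lemma normal_eq (hε : ε = 1 ∨ ε = -1) (hV : Module.finrank ℝ V = 3) {w : V} (hu : u ∈ B)
    (hw : w ∈ B) : n u = n w := by
  refine h.isOpen.is_const_of_fderiv_eq_zero (𝕜 := ℝ) h.isPreconnected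
    (h.smooth_normal.differentiableOn (by simp)) (fun z hz => ?_) hu hw
  rw [h.fderiv_normal_eq hε hV hz, h.shape_eq_zero hε hV hz]
  simp

end IsUmbilicalPatch

end Patch

/-! ### Local smooth unit normal fields -/

section NormalField

variable {ε : ℝ} {V : Type*} [NormedAddCommGroup V] [NormedSpace ℝ V]

/-- The linear map whose kernel is the normal space of `f` at `u`, complemented by the product with
a fixed vector `ν`. -/
noncomputable def normalSystem {ι : Type*} [Fintype ι] (ε : ℝ) (b : ι → V) (f : V → E6) (ν : E6)
    (u : V) : E6 →L[ℝ] (ι → ℝ) × ℝ × ℝ × ℝ :=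
  (ContinuousLinearMap.pi fun i => (prodFormL ε).flip (fderiv ℝ f u (b i))).prod
    ((((formL ε).flip (f u).1).comp (ContinuousLinearMap.fst ℝ E3 E3)).prod
      ((((formL ε).flip (f u).2).comp (ContinuousLinearMap.snd ℝ E3 E3)).prod
        ((prodFormL ε).flip ν)))

lemma normalSystem_apply {ι : Type*} [Fintype ι] (b : ι → V) (f : V → E6) (ν : E6) (u : V)
    (m : E6) : normalSystem ε b f ν u m = (fun i => prodForm ε m (fderiv ℝ f u (b i)),
      form ε m.1 (f u).1, form ε m.2 (f u).2, prodForm ε m ν) := rfl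

lemma contDiffOn_normalSystem {ι : Type*} [Fintype ι] (b : ι → V) {f : V → E6} (ν : E6)
    {W : Set V} (hW : IsOpen W) (hf : ContDiffOn ℝ ∞ f W) :
    ContDiffOn ℝ ∞ (normalSystem ε b f ν) W := by
  have hdf : ContDiffOn ℝ ∞ (fderiv ℝ f) W := hf.fderiv_of_isOpen hW (by simp)
  rw [contDiffOn_clm_apply]
  intro m
  refine ContDiffOn.prodMk (contDiffOn_pi.2 fun i => ?_)
    (ContDiffOn.prodMk ?_ (ContDiffOn.prodMk ?_ contDiffOn_const))
  · exact (prodFormL ε m).contDiff.comp_contDiffOn (hdf.clm_apply contDiffOn_const)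
  · exact (formL ε m.1).contDiff.comp_contDiffOn hf.fst
  · exact (formL ε m.2).contDiff.comp_contDiffOn hf.snd

/-- With `ν` normal at `u₀`, the square system `normalSystem` is invertible at `u₀`, hence nearby.
Its solutions depend smoothly on the point and are then normalized. -/
lemma exists_unit_normal_field (hε : ε = 1 ∨ ε = -1) (hV : Module.finrank ℝ V = 3) {f : V → E6}
    {W : Set V} (hW : IsOpen W) (hf : ContDiffOn ℝ ∞ f W)
    (hemb : ∀ u ∈ W, IsTangentEmbedding ε (f u) (fderiv ℝ f u)) {u₀ : V} (hu₀ : u₀ ∈ W) :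
    ∃ (B : Set V) (n : V → E6), B ⊆ W ∧ u₀ ∈ B ∧ IsOpen B ∧ IsPreconnected B ∧
      ContDiffOn ℝ ∞ n B ∧ (∀ u ∈ B, IsNormalVector ε (f u) (fderiv ℝ f u) (n u)) ∧
      ∀ u ∈ B, prodForm ε (n u) (n u) = 1 := by
  have : FiniteDimensional ℝ V := .of_finrank_pos (by omega)
  let b := Module.finBasisOfFinrankEq ℝ V hV
  have hspan : ∀ (u : V) (m : E6), (∀ i, prodForm ε m (fderiv ℝ f u (b i)) = 0) →
      ∀ v, prodForm ε m (fderiv ℝ f u v) = 0 := fun u m h v => by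
    have hb : (prodFormL ε m).toLinearMap ∘ₗ (fderiv ℝ f u).toLinearMap = 0 := b.ext h
    exact LinearMap.congr_fun hb v
  obtain ⟨ν, hν⟩ := exists_isNormalVector (ε := ε) hV (f u₀) (fderiv ℝ f u₀)
  set T := normalSystem ε b f ν with hT
  have hTs : ContDiffOn ℝ ∞ T W := contDiffOn_normalSystem b ν hW hf
  have hinj : Function.Injective (T u₀).toLinearMap := by
    rw [← LinearMap.ker_eq_bot, LinearMap.ker_eq_bot']
    intro m hm
    have hm : T u₀ m = 0 := hm
    simp only [hT, normalSystem_apply, Prod.mk_eq_zero] at hm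
    exact (hemb u₀ hu₀).eq_zero_of_orthogonal hε hV hν (hspan u₀ m (congrFun hm.1)) hm.2.2.2
      ⟨hm.2.1, hm.2.2.1⟩
  let e := ((T u₀).toLinearMap.linearEquivOfInjective hinj (by simp)).toContinuousLinearEquiv
  have he : (e : E6 →L[ℝ] (Fin 3 → ℝ) × ℝ × ℝ × ℝ) = T u₀ := by ext <;> rfl
  have hnhds : T ⁻¹' Set.range ContinuousLinearEquiv.toContinuousLinearMap ∈ nhds u₀ := by
    refine (hTs.contDiffAt (hW.mem_nhds hu₀)).continuousAt ?_
    rw [← he]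
    exact e.nhds
  obtain ⟨r, hr, hball⟩ := Metric.mem_nhds_iff.1 (Filter.inter_mem (hW.mem_nhds hu₀) hnhds)
  -- The zeros say that `n₀` is tangent to the product and normal to `f`; the last entry, `⟨n₀, ν⟩ =
  -- 1`, keeps it from vanishing.
  set n₀ : V → E6 := fun u => (T u).inverse (0, 0, 0, 1) with hn₀
  have hsol : ∀ u ∈ Metric.ball u₀ r, T u (n₀ u) = (0, 0, 0, 1) := fun u hu => by
    obtain ⟨e', he'⟩ := (hball hu).2
    simp only [hn₀, ← he']
    rw [show e'.toContinuousLinearMap.inverse = e'.symm from ContinuousLinearMap.inverse_equiv e']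
    exact e'.apply_symm_apply _
  have hn₀s : ContDiffOn ℝ ∞ n₀ (Metric.ball u₀ r) := fun u hu => by
    obtain ⟨e', he'⟩ := (hball hu).2
    have h1 := contDiffAt_map_inverse (n := ∞) e'
    rw [he'] at h1
    have h2 : ContDiffAt ℝ ∞ T u := hTs.contDiffAt (hW.mem_nhds (hball hu).1)
    exact ((h1.comp u h2).clm_apply contDiffAt_const).contDiffWithinAt
  have hnormal : ∀ u ∈ Metric.ball u₀ r, IsNormalVector ε (f u) (fderiv ℝ f u) (n₀ u) :=
    fun u hu => by
      have h := hsol u hu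
      simp only [hT, normalSystem_apply, Prod.mk.injEq] at h
      refine ⟨⟨h.2.1, h.2.2.1⟩, hspan u _ (congrFun h.1), fun h0 => ?_⟩
      rw [h0] at h
      simpa using h.2.2.2
  have hpos : ∀ u ∈ Metric.ball u₀ r, 0 < prodForm ε (n₀ u) (n₀ u) := fun u hu =>
    prodForm_self_pos hε (hemb u (hball hu).1).mem (hnormal u hu).tangent (hnormal u hu).ne_zero
  refine ⟨Metric.ball u₀ r, fun u => (√(prodForm ε (n₀ u) (n₀ u)))⁻¹ • n₀ u,
    fun u hu => (hball hu).1, Metric.mem_ball_self hr, Metric.isOpen_ball,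
    (convex_ball u₀ r).isPreconnected, ?_, fun u hu => ?_, fun u hu => ?_⟩
  · have h1 : ContDiffOn ℝ ∞ (fun u => prodFormL ε (n₀ u) (n₀ u)) (Metric.ball u₀ r) :=
      ((prodFormL ε).contDiff.comp_contDiffOn hn₀s).clm_apply hn₀s
    exact ((h1.sqrt fun u hu => (hpos u hu).ne').inv
      fun u hu => (Real.sqrt_pos.2 (hpos u hu)).ne').smul hn₀s
  · have h := hnormal u hu
    exact ⟨Submodule.smul_mem _ _ h.tangent, fun v => by simp [h.orthogonal v],
      smul_ne_zero (inv_ne_zero (Real.sqrt_pos.2 (hpos u hu)).ne') h.ne_zero⟩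
  · have h := hpos u hu
    rw [prodForm_smul_left, prodForm_smul_right, ← mul_assoc, ← mul_inv, Real.mul_self_sqrt h.le,
      inv_mul_cancel₀ h.ne']

end NormalField

/-! ### Local expressions and changes of chart -/

section Manifold

variable {ε : ℝ} {N : Type*} [TopologicalSpace N] [ChartedSpace (EuclideanSpace ℝ (Fin 3)) N]
  {Ψ : N → E6}

/-- The local expression of `Ψ` in the preferred chart at `x`. -/
noncomputable def localExpr (Ψ : N → E6) (x : N) : EuclideanSpace ℝ (Fin 3) → E6 :=
  Ψ ∘ (extChartAt (𝓡 3) x).symm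

lemma IsHypersurface.differential_eq (hΨ : IsHypersurface ε Ψ) (x : N)
    (v : TangentSpace (𝓡 3) x) :
    differential Ψ x v = fderiv ℝ (localExpr Ψ x) (extChartAt (𝓡 3) x x) v := by
  have h : MDifferentiableAt (𝓡 3) 𝓘(ℝ, E6) Ψ x := hΨ.smooth.mdifferentiable (by simp) x
  simp only [differential, mfderiv, h, ModelWithCorners.range_eq_univ,
    fderivWithin_univ]
  rfl

/-- The change of coordinates from the chart at `x` to the chart at `y`. -/
noncomputable def transition (x y : N) : EuclideanSpace ℝ (Fin 3) → EuclideanSpace ℝ (Fin 3) :=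
  extChartAt (𝓡 3) y ∘ (extChartAt (𝓡 3) x).symm

lemma localExpr_eventuallyEq {x y z : N} (hx : z ∈ (extChartAt (𝓡 3) x).source)
    (hy : z ∈ (extChartAt (𝓡 3) y).source) (F : N → E6) :
    F ∘ (extChartAt (𝓡 3) x).symm =ᶠ[nhds (extChartAt (𝓡 3) x z)]
      (F ∘ (extChartAt (𝓡 3) y).symm) ∘ transition x y := by
  have hc : ContinuousAt (extChartAt (𝓡 3) x).symm (extChartAt (𝓡 3) x z) :=
    continuousAt_extChartAt_symm'' ((extChartAt (𝓡 3) x).map_source hx)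
  have h : (extChartAt (𝓡 3) x).symm ⁻¹' (extChartAt (𝓡 3) y).source
      ∈ nhds (extChartAt (𝓡 3) x z) := by
    refine hc ((isOpen_extChartAt_source y).mem_nhds ?_)
    rwa [(extChartAt (𝓡 3) x).left_inv hx]
  filter_upwards [h] with u hu
  simp only [Function.comp_apply, transition]
  rw [(extChartAt (𝓡 3) y).left_inv hu]

section Smooth

variable [IsManifold (𝓡 3) ∞ N]

lemma IsHypersurface.contDiffOn_localExpr (hΨ : IsHypersurface ε Ψ) (x : N) :
    ContDiffOn ℝ ∞ (localExpr Ψ x) (extChartAt (𝓡 3) x).target :=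
  contMDiffOn_iff_contDiffOn.1
    (hΨ.smooth.comp_contMDiffOn (contMDiffOn_extChartAt_symm x))

lemma contDiffAt_transition {x y z : N} (hx : z ∈ (extChartAt (𝓡 3) x).source)
    (hy : z ∈ (extChartAt (𝓡 3) y).source) :
    ContDiffAt ℝ ∞ (transition x y) (extChartAt (𝓡 3) x z) := by
  have h := contDiffWithinAt_ext_coord_change (I := 𝓡 3) (n := ∞) y x
    (y := extChartAt (𝓡 3) x z) ?_
  · rwa [ModelWithCorners.range_eq_univ, contDiffWithinAt_univ] at h
  · rw [PartialEquiv.trans_source]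
    refine ⟨(extChartAt (𝓡 3) x).map_source hx, ?_⟩
    rw [Set.mem_preimage, (extChartAt (𝓡 3) x).left_inv hx]
    exact hy

end Smooth

end Manifold

/-! ### Second fundamental form in charts, and total geodesy -/

section SecondFundamentalForm

variable {ε : ℝ} {N : Type*} [TopologicalSpace N] [ChartedSpace (EuclideanSpace ℝ (Fin 3)) N]
  {Ψ : N → E6}

lemma prodForm_ambientProj {p n : E6} (hn : n ∈ ambientTangent ε p) (u : E6) :
    prodForm ε n (ambientProj ε p u) = prodForm ε n u := by
  simp [prodForm, ambientProj, hn.1, hn.2]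

lemma orthProj_spec (hε : ε = 1 ∨ ε = -1) {p : E6} (hp : p ∈ M2 ε ×ˢ M2 ε)
    (W : Submodule ℝ E6) (hW : W ≤ ambientTangent ε p) (u : E6) :
    orthProj ε W u ∈ W ∧ ∀ m ∈ W, prodForm ε (u - orthProj ε W u) m = 0 := by
  have h := (existsUnique_orthProj hε hp W hW u).exists
  rw [orthProj, dif_pos h]
  exact h.choose_spec

lemma normalSpace_le (ε : ℝ) (Ψ : N → E6) (x : N) :
    normalSpace ε Ψ x ≤ ambientTangent ε (Ψ x) := fun _ h => h.1

lemma IsHypersurface.secondFundamentalForm_mem (hε : ε = 1 ∨ ε = -1) (hΨ : IsHypersurface ε Ψ)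
    (x : N) (v w : TangentSpace (𝓡 3) x) :
    secondFundamentalForm ε Ψ x v w ∈ normalSpace ε Ψ x :=
  (orthProj_spec hε (hΨ.mem x) _ (normalSpace_le ε Ψ x) _).1

/-- Both projections in the definition of `σ` remove only vectors orthogonal to `n`. -/
lemma IsHypersurface.prodForm_secondFundamentalForm (hε : ε = 1 ∨ ε = -1)
    (hΨ : IsHypersurface ε Ψ) (x : N) (v w : TangentSpace (𝓡 3) x) {n : E6}
    (hn : n ∈ normalSpace ε Ψ x) :
    prodForm ε n (secondFundamentalForm ε Ψ x v w) = prodForm ε n (flatDerivative Ψ x v w) := by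
  have h := (orthProj_spec hε (hΨ.mem x) _ (normalSpace_le ε Ψ x)
    (leviCivitaDerivative ε Ψ x v w)).2 n hn
  rw [prodForm_sub_left, sub_eq_zero] at h
  rw [secondFundamentalForm, prodForm_comm, ← h, prodForm_comm, leviCivitaDerivative,
    prodForm_ambientProj hn.1]

lemma IsHypersurface.meanCurvatureVector_mem (hε : ε = 1 ∨ ε = -1) (hΨ : IsHypersurface ε Ψ)
    (x : N) : meanCurvatureVector ε Ψ x ∈ normalSpace ε Ψ x :=
  Submodule.smul_mem _ _ (Submodule.sum_mem _ fun _ _ => Submodule.sum_mem _ fun _ _ =>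
    Submodule.smul_mem _ _ (hΨ.secondFundamentalForm_mem hε x _ _))

lemma localExpr_apply {x z : N} (hx : z ∈ (extChartAt (𝓡 3) x).source) :
    localExpr Ψ x (extChartAt (𝓡 3) x z) = Ψ z := by
  rw [localExpr, Function.comp_apply, (extChartAt (𝓡 3) x).left_inv hx]

variable [IsManifold (𝓡 3) ∞ N]

/-- The inverse is the derivative of the reverse transition, by the chain rule. -/
lemma exists_transition_equiv {x y z : N} (hx : z ∈ (extChartAt (𝓡 3) x).source)
    (hy : z ∈ (extChartAt (𝓡 3) y).source) :
    ∃ e : EuclideanSpace ℝ (Fin 3) ≃L[ℝ] EuclideanSpace ℝ (Fin 3),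
      HasFDerivAt (transition x y) (e : _ →L[ℝ] EuclideanSpace ℝ (Fin 3))
        (extChartAt (𝓡 3) x z) := by
  have key : ∀ {x y : N}, z ∈ (extChartAt (𝓡 3) x).source → z ∈ (extChartAt (𝓡 3) y).source →
      (fderiv ℝ (transition y x) (extChartAt (𝓡 3) y z)).comp
        (fderiv ℝ (transition x y) (extChartAt (𝓡 3) x z)) = .id ℝ _ := by
    intro x y hx hy
    have h1 := ((contDiffAt_transition hx hy).differentiableAt (by simp)).hasFDerivAt
    have h2 := ((contDiffAt_transition hy hx).differentiableAt (by simp)).hasFDerivAt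
    have hxy : transition x y (extChartAt (𝓡 3) x z) = extChartAt (𝓡 3) y z := by
      simp only [transition, Function.comp_apply, (extChartAt (𝓡 3) x).left_inv hx]
    rw [← hxy] at h2
    have h3 := h2.comp _ h1
    rw [hxy] at h3
    refine h3.unique ((hasFDerivAt_id _).congr_of_eventuallyEq ?_)
    have hc : ContinuousAt (extChartAt (𝓡 3) x).symm (extChartAt (𝓡 3) x z) :=
      continuousAt_extChartAt_symm'' ((extChartAt (𝓡 3) x).map_source hx)
    have h : (extChartAt (𝓡 3) x).symm ⁻¹' (extChartAt (𝓡 3) y).source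
        ∈ nhds (extChartAt (𝓡 3) x z) := by
      refine hc ((isOpen_extChartAt_source y).mem_nhds ?_)
      rwa [(extChartAt (𝓡 3) x).left_inv hx]
    filter_upwards [h, (isOpen_extChartAt_target x).mem_nhds
      ((extChartAt (𝓡 3) x).map_source hx)] with u hu hu'
    simp only [Function.comp_apply, transition, id]
    rw [(extChartAt (𝓡 3) y).left_inv hu, (extChartAt (𝓡 3) x).right_inv hu']
  refine ⟨ContinuousLinearEquiv.equivOfInverse
    (fderiv ℝ (transition x y) (extChartAt (𝓡 3) x z))
    (fderiv ℝ (transition y x) (extChartAt (𝓡 3) y z))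
    (fun v => DFunLike.congr_fun (key hx hy) v) (fun v => DFunLike.congr_fun (key hy hx) v), ?_⟩
  exact ((contDiffAt_transition hx hy).differentiableAt (by simp)).hasFDerivAt

/-- The geometry at `z` is defined in the preferred chart at `z`, whereas a patch lives in one fixed
chart at `x`. The equivalence `e` translates between them. -/
lemma IsHypersurface.exists_fderiv_localExpr (hΨ : IsHypersurface ε Ψ) {x z : N}
    (hx : z ∈ (extChartAt (𝓡 3) x).source) :
    ∃ e : EuclideanSpace ℝ (Fin 3) ≃L[ℝ] EuclideanSpace ℝ (Fin 3),
      HasFDerivAt (transition z x) (e : _ →L[ℝ] EuclideanSpace ℝ (Fin 3))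
        (extChartAt (𝓡 3) z z) ∧
      ∀ v : EuclideanSpace ℝ (Fin 3), differential Ψ z v
        = fderiv ℝ (localExpr Ψ x) (extChartAt (𝓡 3) x z) (e v) := by
  have hz := mem_extChartAt_source (I := 𝓡 3) z
  obtain ⟨e, he⟩ := exists_transition_equiv hz hx
  refine ⟨e, he, fun v => ?_⟩
  have hzx : transition z x (extChartAt (𝓡 3) z z) = extChartAt (𝓡 3) x z := by
    simp only [transition, Function.comp_apply, (extChartAt (𝓡 3) z).left_inv hz]
  have hf := (((hΨ.contDiffOn_localExpr x).contDiffAt ((isOpen_extChartAt_target x).mem_nhds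
    ((extChartAt (𝓡 3) x).map_source hx))).differentiableAt (by simp)).hasFDerivAt
  rw [← hzx] at hf
  refine (hΨ.differential_eq z v).trans ?_
  rw [← hzx]
  exact DFunLike.congr_fun ((hf.comp _ he).congr_of_eventuallyEq
    (localExpr_eventuallyEq hz hx Ψ)).fderiv v

lemma IsHypersurface.isTangentEmbedding (hΨ : IsHypersurface ε Ψ) {x : N}
    {u : EuclideanSpace ℝ (Fin 3)} (hu : u ∈ (extChartAt (𝓡 3) x).target) :
    IsTangentEmbedding ε (localExpr Ψ x u) (fderiv ℝ (localExpr Ψ x) u) := by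
  have hf := (((hΨ.contDiffOn_localExpr x).contDiffAt ((isOpen_extChartAt_target x).mem_nhds
    hu)).differentiableAt (by simp)).hasFDerivAt
  refine ⟨hΨ.mem _, ?_, fun v => ?_⟩
  · set z := (extChartAt (𝓡 3) x).symm u with hz
    have hzx : z ∈ (extChartAt (𝓡 3) x).source := (extChartAt (𝓡 3) x).map_target hu
    have huz : extChartAt (𝓡 3) x z = u := (extChartAt (𝓡 3) x).right_inv hu
    obtain ⟨e, -, he⟩ := hΨ.exists_fderiv_localExpr hzx
    intro v w hvw
    rw [← huz, ← e.apply_symm_apply v, ← e.apply_symm_apply w, ← he, ← he] at hvw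
    exact e.symm.injective (hΨ.immersion z hvw)
  · have h1 := form_fderiv_eq_zero (ε := ε) hf.fst hf.fst
      (Filter.Eventually.of_forall fun z => (hΨ.mem ((extChartAt (𝓡 3) x).symm z)).1.1) v
    have h2 := form_fderiv_eq_zero (ε := ε) hf.snd hf.snd
      (Filter.Eventually.of_forall fun z => (hΨ.mem ((extChartAt (𝓡 3) x).symm z)).2.1) v
    rw [form_comm (Prod.fst _)] at h1
    rw [form_comm (Prod.snd _)] at h2
    constructor
    · exact self_eq_neg.1 (eq_neg_of_add_eq_zero_left h1)
    · exact self_eq_neg.1 (eq_neg_of_add_eq_zero_left h2)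

lemma IsHypersurface.mem_normalSpace (hΨ : IsHypersurface ε Ψ) {x z : N}
    (hx : z ∈ (extChartAt (𝓡 3) x).source) {n : E6} : n ∈ normalSpace ε Ψ z ↔
      n ∈ ambientTangent ε (Ψ z) ∧
        ∀ v, prodForm ε n (fderiv ℝ (localExpr Ψ x) (extChartAt (𝓡 3) x z) v) = 0 := by
  obtain ⟨e, -, he⟩ := hΨ.exists_fderiv_localExpr hx
  refine and_congr_right fun _ => ⟨fun h v => ?_, fun h v => ?_⟩
  · rw [← e.apply_symm_apply v, ← he]
    exact h _
  · exact (congrArg _ (he v)).trans (h _)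

/-- The Weingarten equation of a totally umbilical hypersurface, in an arbitrary chart. -/
lemma IsHypersurface.weingarten (hε : ε = 1 ∨ ε = -1) (hΨ : IsHypersurface ε Ψ)
    (humb : IsTotallyUmbilical ε Ψ) {x : N} {B : Set (EuclideanSpace ℝ (Fin 3))}
    {n : EuclideanSpace ℝ (Fin 3) → E6} (hB : IsOpen B) (hBt : B ⊆ (extChartAt (𝓡 3) x).target)
    (hn : ContDiffOn ℝ ∞ n B)
    (hnormal : ∀ u ∈ B,
      IsNormalVector ε (localExpr Ψ x u) (fderiv ℝ (localExpr Ψ x) u) (n u))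
    {u : EuclideanSpace ℝ (Fin 3)} (hu : u ∈ B) (v w : EuclideanSpace ℝ (Fin 3)) :
    prodForm ε (fderiv ℝ n u v) (fderiv ℝ (localExpr Ψ x) u w)
      = -prodForm ε (n u) (meanCurvatureVector ε Ψ ((extChartAt (𝓡 3) x).symm u)) *
        prodForm ε (fderiv ℝ (localExpr Ψ x) u v) (fderiv ℝ (localExpr Ψ x) u w) := by
  set f := localExpr Ψ x with hf
  set z := (extChartAt (𝓡 3) x).symm u with hz
  have hzx : z ∈ (extChartAt (𝓡 3) x).source := (extChartAt (𝓡 3) x).map_target (hBt hu)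
  have huz : extChartAt (𝓡 3) x z = u := (extChartAt (𝓡 3) x).right_inv (hBt hu)
  have hzz := mem_extChartAt_source (I := 𝓡 3) z
  obtain ⟨e, he, hde⟩ := hΨ.exists_fderiv_localExpr hzx
  rw [huz] at hde
  set s := extChartAt (𝓡 3) z z with hs
  set τ := transition z x with hτ
  set g := localExpr Ψ z with hg
  have hτs : τ s = u := by
    simp only [hτ, hs, transition, Function.comp_apply, (extChartAt (𝓡 3) z).left_inv hzz, huz]
  have hτc : ContDiffAt ℝ ∞ τ s := contDiffAt_transition hzz hzx
  have hnz : n u ∈ normalSpace ε Ψ z := by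
    refine (hΨ.mem_normalSpace hzx).2 ⟨?_, ?_⟩
    · rw [← localExpr_apply (Ψ := Ψ) hzx, huz]
      exact (hnormal u hu).tangent
    · rw [huz]
      exact (hnormal u hu).orthogonal
  have hgc : ContDiffAt ℝ ∞ g s := (hΨ.contDiffOn_localExpr z).contDiffAt
    ((isOpen_extChartAt_target z).mem_nhds ((extChartAt (𝓡 3) z).map_source hzz))
  have h2 : HasFDerivAt (fderiv ℝ g) (fderiv ℝ (fderiv ℝ g) s) s :=
    ((hgc.fderiv_right (m := 1) one_add_one_le_infty).differentiableAt (by simp)).hasFDerivAt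
  have hnd : HasFDerivAt n (fderiv ℝ n u) (τ s) := by
    rw [hτs]
    exact ((hn.contDiffAt (hB.mem_nhds hu)).differentiableAt (by simp)).hasFDerivAt
  -- The normal field is moved to the chart at `z`, the one in which `σ` at `z` is defined.
  -- Differentiating this orthogonality gives `⟨dn, df⟩ = -⟨n, σ⟩`.
  have horth : ∀ w', ∀ᶠ t in nhds s, prodForm ε (n (τ t)) (fderiv ℝ g t w') = 0 := by
    intro w'
    have hτB : ∀ᶠ t in nhds s, τ t ∈ B :=
      hτc.continuousAt (hB.mem_nhds (by rwa [hτs]))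
    have hτd : ∀ᶠ t in nhds s, ContDiffAt ℝ 1 τ t :=
      (hτc.of_le (by exact_mod_cast le_top)).eventually (by simp)
    have hgf : g =ᶠ[nhds s] f ∘ τ := localExpr_eventuallyEq hzz hzx Ψ
    filter_upwards [hτB, hτd, hgf.eventuallyEq_nhds] with t htB htd htg
    have hfd := (((hΨ.contDiffOn_localExpr x).contDiffAt ((isOpen_extChartAt_target x).mem_nhds
      (hBt htB))).differentiableAt (by simp)).hasFDerivAt
    have h3 := (hfd.comp t (htd.differentiableAt (by simp)).hasFDerivAt).congr_of_eventuallyEq htg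
    rw [h3.fderiv]
    exact (hnormal _ htB).orthogonal _
  have key : ∀ v' w', prodForm ε (fderiv ℝ n u (e v')) (fderiv ℝ f u (e w'))
      = -prodForm ε (n u) (meanCurvatureVector ε Ψ z) *
        prodForm ε (fderiv ℝ f u (e v')) (fderiv ℝ f u (e w')) := by
    intro v' w'
    have h3 := prodForm_fderiv_eq_zero (hnd.comp s he)
      (h2.clm_apply (hasFDerivAt_const w' s)) (horth w') v'
    have h4 : fderiv ℝ g s w' = fderiv ℝ f u (e w') :=
      (hΨ.differential_eq z w').symm.trans (hde w')
    have h5 := hΨ.prodForm_secondFundamentalForm hε z v' w' hnz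
    rw [humb z v' w', prodForm_smul_right] at h5
    have h6 : inducedMetric ε Ψ z v' w' = prodForm ε (fderiv ℝ f u (e v')) (fderiv ℝ f u (e w')) :=
      congrArg₂ (prodForm ε) (hde v') (hde w')
    have h7 : flatDerivative Ψ z v' w' = fderiv ℝ (fderiv ℝ g) s v' w' := rfl
    rw [h6, h7] at h5
    simp [h4, hτs] at h3
    linear_combination h3 + h5
  simpa using key (e.symm v) (e.symm w)

lemma IsHypersurface.exists_isUmbilicalPatch (hε : ε = 1 ∨ ε = -1) (hΨ : IsHypersurface ε Ψ)
    (humb : IsTotallyUmbilical ε Ψ) (hcmc : HasConstantMeanCurvature ε Ψ) (x : N) :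
    ∃ (l : ℝ) (B : Set (EuclideanSpace ℝ (Fin 3))) (n : EuclideanSpace ℝ (Fin 3) → E6),
      B ⊆ (extChartAt (𝓡 3) x).target ∧ extChartAt (𝓡 3) x x ∈ B ∧
      IsUmbilicalPatch ε l B (localExpr Ψ x) n ∧
      ∀ u ∈ B, prodForm ε (n u) (meanCurvatureVector ε Ψ ((extChartAt (𝓡 3) x).symm u)) = l := by
  have hV : Module.finrank ℝ (EuclideanSpace ℝ (Fin 3)) = 3 := by simp
  obtain ⟨B, n, hBt, hxB, hB, hBc, hn, hnormal, hunit⟩ := exists_unit_normal_field hε hV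
    (isOpen_extChartAt_target x) (hΨ.contDiffOn_localExpr x) (fun u hu => hΨ.isTangentEmbedding hu)
    (mem_extChartAt_target x)
  obtain ⟨c, hc⟩ := hcmc
  set f := localExpr Ψ x with hf
  set lam : EuclideanSpace ℝ (Fin 3) → ℝ := fun u =>
    prodForm ε (n u) (meanCurvatureVector ε Ψ ((extChartAt (𝓡 3) x).symm u)) with hlam
  have hW : ∀ u ∈ B, ∀ v w, prodForm ε (fderiv ℝ n u v) (fderiv ℝ f u w)
      = -lam u * prodForm ε (fderiv ℝ f u v) (fderiv ℝ f u w) := fun u hu v w =>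
    hΨ.weingarten hε humb hB hBt hn hnormal hu v w
  have hemb : ∀ u ∈ B, IsTangentEmbedding ε (f u) (fderiv ℝ f u) :=
    fun u hu => hΨ.isTangentEmbedding (hBt hu)
  -- `H` is normal, so `H = lam u • n u` and `|H|² = lam u ^ 2`.
  have hsq : ∀ u ∈ B, lam u ^ 2 = c ^ 2 := by
    intro u hu
    set z := (extChartAt (𝓡 3) x).symm u with hz
    have hzx : z ∈ (extChartAt (𝓡 3) x).source := (extChartAt (𝓡 3) x).map_target (hBt hu)
    have huz : extChartAt (𝓡 3) x z = u := (extChartAt (𝓡 3) x).right_inv (hBt hu)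
    have hH := (hΨ.mem_normalSpace hzx).1 (hΨ.meanCurvatureVector_mem hε z)
    rw [huz] at hH
    have hHt : meanCurvatureVector ε Ψ z ∈ ambientTangent ε (f u) := hH.1
    have h1 := (hemb u hu).eq_smul_normal hε hV (hnormal u hu) (hunit u hu) hH.2 hHt
    have h2 : prodForm ε (meanCurvatureVector ε Ψ z) (meanCurvatureVector ε Ψ z) = lam u ^ 2 := by
      conv_lhs => rw [h1]
      rw [prodForm_smul_left, prodForm_smul_right, hunit u hu, prodForm_comm]
      ring
    rw [← hc z, h2, Real.sqrt_sq_eq_abs, sq_abs]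
  -- The definition of `H` changes chart from point to point, so continuity is not visible there.
  -- The Weingarten equation with a fixed `v = w ≠ 0` writes `lam` as a quotient of continuous
  -- functions.
  have hcont : ContinuousOn lam B := by
    obtain ⟨v, hv⟩ := exists_ne (0 : EuclideanSpace ℝ (Fin 3))
    have hne : ∀ u ∈ B, prodForm ε (fderiv ℝ f u v) (fderiv ℝ f u v) ≠ 0 := fun u hu =>
      (prodForm_self_pos hε (hemb u hu).mem ((hemb u hu).tangent v) fun h0 =>
        hv ((hemb u hu).injective (by simpa using h0))).ne'
    have hdf : ContinuousOn (fun u => fderiv ℝ f u v) B :=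
      ((((hΨ.contDiffOn_localExpr x).mono hBt).fderiv_of_isOpen (m := 0) hB
        (by simp)).continuousOn).clm_apply continuousOn_const
    have hdn : ContinuousOn (fun u => fderiv ℝ n u v) B :=
      ((hn.fderiv_of_isOpen (m := 0) hB (by simp)).continuousOn).clm_apply continuousOn_const
    have h1 : ContinuousOn (fun u => prodFormL ε (fderiv ℝ n u v) (fderiv ℝ f u v)) B :=
      ((prodFormL ε).continuous.comp_continuousOn hdn).clm_apply hdf
    have h2 : ContinuousOn (fun u => prodFormL ε (fderiv ℝ f u v) (fderiv ℝ f u v)) B :=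
      ((prodFormL ε).continuous.comp_continuousOn hdf).clm_apply hdf
    refine (h1.neg.div h2 hne).congr fun u hu => ?_
    have h3 := hW u hu v v
    simp only [Pi.div_apply, Pi.neg_apply, prodFormL_apply, h3]
    field_simp [hne u hu]
  -- For `c ≠ 0`, a continuous function with square `c ^ 2` cannot change sign on the connected set
  -- `B`.
  obtain ⟨l, hl⟩ : ∃ l, ∀ u ∈ B, lam u = l := by
    by_cases hc0 : c = 0
    · exact ⟨0, fun u hu => by simpa [hc0] using hsq u hu⟩
    · rcases hBc.eq_or_eq_neg_of_sq_eq hcont continuousOn_const (fun u hu => hsq u hu)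
        (fun _ => hc0) with h | h
      · exact ⟨c, h⟩
      · exact ⟨-c, h⟩
  refine ⟨l, B, n, hBt, hxB, ⟨hB, hBc, (hΨ.contDiffOn_localExpr x).mono hBt, hn, hemb, hnormal,
    hunit, fun u hu v w => ?_⟩, hl⟩
  rw [hW u hu, hl u hu]

theorem IsHypersurface.isTotallyGeodesic (hε : ε = 1 ∨ ε = -1) (hΨ : IsHypersurface ε Ψ)
    (humb : IsTotallyUmbilical ε Ψ) (hcmc : HasConstantMeanCurvature ε Ψ) :
    IsTotallyGeodesic ε Ψ := by
  intro x v w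
  have hV : Module.finrank ℝ (EuclideanSpace ℝ (Fin 3)) = 3 := by simp
  obtain ⟨l, B, n, -, hxB, hP, hl⟩ := hΨ.exists_isUmbilicalPatch hε humb hcmc x
  have hx := mem_extChartAt_source (I := 𝓡 3) x
  have hH := (hΨ.mem_normalSpace hx).1 (hΨ.meanCurvatureVector_mem hε x)
  have hl := hl _ hxB
  rw [hP.shape_eq_zero hε hV hxB, (extChartAt (𝓡 3) x).left_inv hx, prodForm_comm] at hl
  rw [← localExpr_apply (Ψ := Ψ) hx] at hH
  have h1 := (hP.embedding _ hxB).eq_smul_normal hε hV (hP.normal _ hxB) (hP.unit _ hxB) hH.2 hH.1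
  rw [hl, zero_smul] at h1
  rw [humb x v w, h1, smul_zero]

end SecondFundamentalForm

/-! ### Isometries of the factors and geodesics -/

section Congruence

variable {ε : ℝ}

lemma exists_isometry_of_frame (hε : ε ≠ 0) {a b c : E3} (haa : form ε a a = 1)
    (hbb : form ε b b = 1) (hcc : form ε c c = ε) (hab : form ε a b = 0) (hac : form ε a c = 0)
    (hbc : form ε b c = 0) : ∃ A : E3 ≃ₗ[ℝ] E3, (∀ x, A x = x 0 • a + x 1 • b + x 2 • c) ∧
      ∀ x y, form ε (A x) (A y) = form ε x y := by
  let T : E3 →ₗ[ℝ] E3 :=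
    { toFun := fun x => x 0 • a + x 1 • b + x 2 • c
      map_add' := by intro x y; simp only [Pi.add_apply]; module
      map_smul' := by intro r x; simp only [Pi.smul_apply, smul_eq_mul, RingHom.id_apply]; module }
  have hT : ∀ x y, form ε (T x) (T y) = form ε x y := by
    intro x y
    simp only [T, LinearMap.coe_mk, AddHom.coe_mk, form_add_left, form_add_right, form_smul_left,
      form_smul_right, haa, hbb, hcc, hab, hac, hbc, form_comm b a, form_comm c a, form_comm c b]
    simp only [form]
    ring
  have hinj : Function.Injective T := by
    rw [← LinearMap.ker_eq_bot, LinearMap.ker_eq_bot']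
    intro x hx
    exact eq_zero_of_forall_form hε fun y => by rw [← hT, hx, form_zero_left]
  exact ⟨LinearEquiv.ofInjectiveEndo T hinj, fun _ => rfl, hT⟩

/-- Reversed Cauchy-Schwarz: the product with a point of the upper sheet detects the sheet. -/
lemma form_neg_of_mem {x p : E3} (hx : x ∈ M2 (-1)) (hp : p ∈ M2 (-1)) : form (-1) x p < 0 := by
  obtain ⟨hx1, hx2⟩ := hx
  obtain ⟨hp1, hp2⟩ := hp
  have hx2 := hx2 rfl
  have hp2 := hp2 rfl
  simp only [form] at *
  have h : x 0 * p 0 + x 1 * p 1 < x 2 * p 2 := by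
    refine lt_of_pow_lt_pow_left₀ 2 (by positivity) ?_
    have h1 : (x 2 * p 2) ^ 2 = (1 + x 0 ^ 2 + x 1 ^ 2) * (1 + p 0 ^ 2 + p 1 ^ 2) := by
      rw [show 1 + x 0 ^ 2 + x 1 ^ 2 = x 2 ^ 2 by linarith,
        show 1 + p 0 ^ 2 + p 1 ^ 2 = p 2 ^ 2 by linarith]
      ring
    rw [h1]
    nlinarith [sq_nonneg (x 0 * p 1 - x 1 * p 0), sq_nonneg (x 0), sq_nonneg (x 1),
      sq_nonneg (p 0), sq_nonneg (p 1)]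
  linarith

lemma mem_M2_of_form_neg {x p : E3} (hx : form (-1) x x = -1) (hp : p ∈ M2 (-1))
    (h : form (-1) x p < 0) : x ∈ M2 (-1) := by
  refine ⟨hx, fun _ => ?_⟩
  by_contra! hneg
  have hne : x 2 ≠ 0 := fun h0 => by
    simp only [form, h0] at hx
    nlinarith [sq_nonneg (x 0), sq_nonneg (x 1)]
  have hmem : -x ∈ M2 (-1) := ⟨by simpa using hx, fun _ => by
    simpa using lt_of_le_of_ne hneg hne⟩
  have := form_neg_of_mem hmem hp
  rw [form_neg_left] at this
  linarith

/-- For `ε = -1` an isometry could exchange the two sheets; one point that stays in the upper sheet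
excludes this. -/
lemma image_M2_of_isometry (A : E3 ≃ₗ[ℝ] E3)
    (hA : ∀ x y, form ε (A x) (A y) = form ε x y)
    (hp : ε = -1 → ∃ p ∈ M2 ε, A p ∈ M2 ε) : A '' M2 ε = M2 ε := by
  have key : ∀ x, A x ∈ M2 ε ↔ x ∈ M2 ε := by
    intro x
    by_cases hε : ε = -1
    · subst hε
      obtain ⟨p, hp, hAp⟩ := hp rfl
      constructor
      · intro h
        refine mem_M2_of_form_neg (by rw [← hA]; exact h.1) hp ?_
        rw [← hA]
        exact form_neg_of_mem h hAp
      · intro h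
        refine mem_M2_of_form_neg (by rw [hA]; exact h.1) hAp ?_
        rw [hA]
        exact form_neg_of_mem h hp
    · exact ⟨fun h => ⟨by rw [← hA]; exact h.1, fun h => absurd h hε⟩,
        fun h => ⟨by rw [hA]; exact h.1, fun h => absurd h hε⟩⟩
  ext y
  constructor
  · rintro ⟨x, hx, rfl⟩
    exact (key x).2 hx
  · intro hy
    exact ⟨A.symm y, (key _).1 (by simpa using hy), by simp⟩

/-- The geodesic `ν^⊥ ∩ M²(ε)` is near each of its points the image of the standard geodesic under
an isometry, and the arc length parameter extends smoothly. -/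
lemma exists_geodesic_parameter (hε : ε = 1 ∨ ε = -1) {q ν : E3} (hq : q ∈ M2 ε)
    (hν : form ε ν ν = 1) (hνq : form ε ν q = 0) :
    ∃ (A : E3 ≃ₗ[ℝ] E3) (O : Set E3) (t : E3 → ℝ), (∀ x y, form ε (A x) (A y) = form ε x y) ∧
      A '' M2 ε = M2 ε ∧ IsOpen O ∧ q ∈ O ∧ ContDiffOn ℝ ∞ t O ∧
      ∀ y ∈ O, y ∈ M2 ε → form ε ν y = 0 → y = A (geodesic ε (t y)) := by
  have hε0 := ne_zero_of_eq_one_or hε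
  obtain ⟨τ, hτq, hτν, hτ⟩ : ∃ τ, form ε τ q = 0 ∧ form ε τ ν = 0 ∧ form ε τ τ = 1 := by
    obtain ⟨e, ⟨heq, heν⟩, he0⟩ := exists_ne_zero_form_eq_zero ε q ν
    have hpos := form_self_pos hε hq heq he0
    refine ⟨(√(form ε e e))⁻¹ • e, by simp [heq], by simp [heν], ?_⟩
    rw [form_smul_left, form_smul_right, ← mul_assoc, ← mul_inv, Real.mul_self_sqrt hpos.le,
      inv_mul_cancel₀ hpos.ne']
  have hτc : ContDiff ℝ ∞ fun y => form ε y τ := ((formL ε).flip τ).contDiff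
  have hqc : ContDiff ℝ ∞ fun y => form ε y q := ((formL ε).flip q).contDiff
  have hqq := hq.1
  rcases hε with rfl | rfl
  -- The standard circle lies in `x₃ = 0`, so `ν` is the last frame vector. On the half with
  -- positive product with `q`, `arcsin` recovers the arc length.
  · obtain ⟨A, hA, hiso⟩ := exists_isometry_of_frame hε0 hqq hτ hν
      (by rw [form_comm]; exact hτq) (by rw [form_comm]; exact hνq) hτν
    refine ⟨A, {y | 0 < form 1 y q} ∩ {y | form 1 y τ ∈ Set.Ioo (-1) 1},
      fun y => Real.arcsin (form 1 y τ), hiso,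
      image_M2_of_isometry A hiso (fun h => by norm_num at h), ?_, ?_, ?_, ?_⟩
    · exact (isOpen_lt continuous_const hqc.continuous).inter
        (isOpen_Ioo.preimage hτc.continuous)
    · refine ⟨by simp [hqq], ?_⟩
      have : form 1 q τ = 0 := by rw [form_comm]; exact hτq
      simp [this]
    · intro y hy
      exact ((Real.contDiffAt_arcsin hy.2.1.ne' hy.2.2.ne).comp y
        hτc.contDiffAt).contDiffWithinAt
    · rintro y ⟨hy1, hy2⟩ hy hyν
      obtain ⟨x, rfl⟩ := A.surjective y
      have hxq : form 1 (A x) q = x 0 := by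
        rw [hA]; simp [hqq, hτq, hνq]
      have hxτ : form 1 (A x) τ = x 1 := by
        rw [hA]; simp [hτ, form_comm q, form_comm ν, hτq, hτν]
      have hxν : form 1 ν (A x) = x 2 := by
        rw [hA]; simp [hν, form_comm ν τ, hτν, hνq]
      have hx := hy.1
      rw [hiso] at hx
      simp only [Set.mem_ofPred_eq, hxτ, hxq] at hy1 hy2
      rw [hxν] at hyν
      simp only [form, hyν] at hx
      congr 1
      beta_reduce
      rw [geodesic, if_pos rfl, hxτ, Real.cos_arcsin, Real.sin_arcsin hy2.1.le hy2.2.le]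
      have h0 : √(1 - x 1 ^ 2) = x 0 := by
        rw [show 1 - x 1 ^ 2 = x 0 ^ 2 by linarith, Real.sqrt_sq hy1.le]
      funext i
      fin_cases i <;> simp [h0, hyν]
  -- The standard hyperbola lies in `x₁ = 0`, so `ν` comes first and the timelike `q` last. Since
  -- `arsinh` is global, no restriction of the domain is needed.
  · obtain ⟨A, hA, hiso⟩ := exists_isometry_of_frame hε0 hν hτ hqq
      (by rw [form_comm]; exact hτν) hνq hτq
    have himg : A '' M2 (-1) = M2 (-1) := image_M2_of_isometry A hiso fun _ =>
      ⟨![0, 0, 1], ⟨by simp [form], fun _ => by simp⟩, by rw [hA]; simpa using hq⟩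
    refine ⟨A, Set.univ, fun y => Real.arsinh (form (-1) y τ), hiso, himg, isOpen_univ,
      Set.mem_univ _, (Real.contDiff_arsinh.comp hτc).contDiffOn, ?_⟩
    rintro y - hy hyν
    obtain ⟨x, hxM, rfl⟩ : y ∈ A '' M2 (-1) := by rwa [himg]
    have hxτ : form (-1) (A x) τ = x 1 := by
      rw [hA]; simp [hτ, form_comm q, form_comm ν, hτq, hτν]
    have hxν : form (-1) ν (A x) = x 0 := by
      rw [hA]; simp [hν, form_comm ν τ, hτν, hνq]
    have hx := hxM.1
    rw [hxν] at hyν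
    simp only [form, hyν] at hx
    congr 1
    beta_reduce
    rw [geodesic, if_neg (by norm_num), hxτ, Real.cosh_arsinh, Real.sinh_arsinh]
    have h0 : √(1 + x 1 ^ 2) = x 2 := by
      rw [show 1 + x 1 ^ 2 = x 2 ^ 2 by linarith, Real.sqrt_sq (hxM.2 rfl).le]
    funext i
    fin_cases i <;> simp [h0, hyν]

lemma isCongruence_prod (A : E3 ≃ₗ[ℝ] E3) (hA : ∀ x y, form ε (A x) (A y) = form ε x y)
    (hM : A '' M2 ε = M2 ε) :
    IsCongruence ε ((LinearEquiv.refl ℝ E3).prodCongr A) := by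
  refine ⟨fun u v => by simp [prodForm, hA], ?_⟩
  have : (⇑((LinearEquiv.refl ℝ E3).prodCongr A) : E6 → E6) = Prod.map id A := rfl
  rw [this, Set.prodMap_image_prod, Set.image_id, hM]

lemma isCongruence_prod_swap (A : E3 ≃ₗ[ℝ] E3) (hA : ∀ x y, form ε (A x) (A y) = form ε x y)
    (hM : A '' M2 ε = M2 ε) :
    IsCongruence ε (((LinearEquiv.refl ℝ E3).prodCongr A).trans
      (LinearEquiv.prodComm ℝ E3 E3)) := by
  refine ⟨fun u v => by simp [prodForm, hA, add_comm], ?_⟩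
  have : (⇑(((LinearEquiv.refl ℝ E3).prodCongr A).trans (LinearEquiv.prodComm ℝ E3 E3)) : E6 → E6)
      = Prod.swap ∘ Prod.map id A := rfl
  rw [this, Set.image_comp, Set.prodMap_image_prod, Set.image_id, hM, Set.image_swap_prod]

end Congruence

/-! ### Inverting a parametrization of `M²(ε) × ℝ` -/

section Straightening

variable {ε : ℝ} {V : Type*} [NormedAddCommGroup V] [NormedSpace ℝ V]

/-- A parametrization `(p, t)` of `M²(ε) × ℝ` has a smooth inverse, which extends smoothly to an
open subset of `ℝ³ × ℝ`. -/
lemma exists_local_inverse (hε : ε ≠ 0) (hV : Module.finrank ℝ V = 3) {B : Set V} (hB : IsOpen B)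
    {p : V → E3} {t : V → ℝ} (hp : ContDiffOn ℝ ∞ p B) (ht : ContDiffOn ℝ ∞ t B)
    (hpM : ∀ u ∈ B, p u ∈ M2 ε) (hpt : ∀ u ∈ B, ∀ v, form ε (fderiv ℝ p u v) (p u) = 0)
    (hinj : ∀ u ∈ B, ∀ v, fderiv ℝ p u v = 0 → fderiv ℝ t u v = 0 → v = 0)
    {u₀ : V} (hu₀ : u₀ ∈ B) :
    ∃ (B' : Set V) (O : Set (E3 × ℝ)) (θ : E3 × ℝ → V), B' ⊆ B ∧ IsOpen B' ∧ u₀ ∈ B' ∧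
      IsOpen O ∧ ContDiffOn ℝ ∞ θ O ∧ (∀ u ∈ B', (p u, t u) ∈ O ∧ θ (p u, t u) = u) ∧
      ∀ z ∈ O, z.1 ∈ M2 ε → θ z ∈ B' ∧ (p (θ z), t (θ z)) = z := by
  have : FiniteDimensional ℝ V := .of_finrank_pos (by omega)
  have : CompleteSpace V := FiniteDimensional.complete ℝ V
  -- A radial coordinate `s` thickens the parametrization to a map between spaces of dimension `4`,
  -- open to the inverse function theorem; the radial direction `p` is transverse to the image of
  -- `dp`.
  let F : V × ℝ → E3 × ℝ := fun w => ((1 + w.2) • p w.1, t w.1)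
  let W : Set (V × ℝ) := B ×ˢ Set.Ioi (-1)
  have hW : IsOpen W := hB.prod isOpen_Ioi
  have hF : ∀ w ∈ W, ContDiffAt ℝ ∞ F w := by
    rintro ⟨u, s⟩ ⟨hu, -⟩
    have h1 : ContDiffAt ℝ ∞ (fun w : V × ℝ => p w.1) (u, s) :=
      (hp.contDiffAt (hB.mem_nhds hu)).comp (u, s) contDiffAt_fst
    have h2 : ContDiffAt ℝ ∞ (fun w : V × ℝ => t w.1) (u, s) :=
      (ht.contDiffAt (hB.mem_nhds hu)).comp (u, s) contDiffAt_fst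
    exact ((contDiffAt_const.add contDiffAt_snd).smul h1).prodMk h2
  have hF' : ∀ w ∈ W, ∃ e : (V × ℝ) ≃L[ℝ] (E3 × ℝ),
      HasFDerivAt F (e : V × ℝ →L[ℝ] E3 × ℝ) w := by
    rintro ⟨u, s⟩ ⟨hu, hs⟩
    have h1 : HasFDerivAt p (fderiv ℝ p u) (u, s).1 :=
      ((hp.contDiffAt (hB.mem_nhds hu)).differentiableAt (by simp)).hasFDerivAt
    have h2 : HasFDerivAt t (fderiv ℝ t u) (u, s).1 :=
      ((ht.contDiffAt (hB.mem_nhds hu)).differentiableAt (by simp)).hasFDerivAt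
    have h3 := (((hasFDerivAt_snd (𝕜 := ℝ) (p := (u, s))).const_add 1).smul
      (h1.comp (u, s) hasFDerivAt_fst)).prodMk (h2.comp (u, s) hasFDerivAt_fst)
    set D := ContinuousLinearMap.prod ((1 + (u, s).2) • (fderiv ℝ p u ∘L .fst ℝ V ℝ) +
      (ContinuousLinearMap.snd ℝ V ℝ).smulRight ((p ∘ Prod.fst) (u, s)))
      (fderiv ℝ t u ∘L .fst ℝ V ℝ) with hD
    have hDi : Function.Injective D.toLinearMap := by
      rw [← LinearMap.ker_eq_bot, LinearMap.ker_eq_bot']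
      rintro ⟨v, r⟩ hvr
      have hvr : ((1 + s) • fderiv ℝ p u v + r • p u, fderiv ℝ t u v) = 0 := hvr
      obtain ⟨h4, h5⟩ := Prod.mk_eq_zero.1 hvr
      have h6 := congrArg (fun x => form ε x (p u)) h4
      have hr : r = 0 := by simpa [hpt u hu, (hpM u hu).1, hε] using h6
      have hs' : 1 + s ≠ 0 := by
        have : -1 < s := hs
        linarith
      rw [hr, zero_smul, add_zero, smul_eq_zero, or_iff_right hs'] at h4
      rw [hinj u hu v h4 h5, hr, Prod.mk_zero_zero]
    refine ⟨(D.toLinearMap.linearEquivOfInjective hDi (by simp [hV])).toContinuousLinearEquiv, ?_⟩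
    exact h3
  have h0W : (u₀, (0 : ℝ)) ∈ W := ⟨hu₀, by simp⟩
  obtain ⟨e, he⟩ := hF' _ h0W
  let G := (hF _ h0W).toOpenPartialHomeomorph F he (by simp)
  have hGF : ∀ w, G w = F w := fun _ => rfl
  have hF0 : ∀ u, F (u, 0) = (p u, t u) := fun u => by simp [F]
  refine ⟨(fun u => (u, (0 : ℝ))) ⁻¹' (G.source ∩ W), G.target ∩ G.symm ⁻¹' W,
    fun z => (G.symm z).1, fun u hu => hu.2.1, ?_, ?_, G.isOpen_inter_preimage_symm hW, ?_, ?_, ?_⟩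
  · exact (G.open_source.inter hW).preimage (by fun_prop)
  · exact ⟨(hF _ h0W).mem_toOpenPartialHomeomorph_source he (by simp), h0W⟩
  · rintro z ⟨hz, hzW⟩
    obtain ⟨e', he'⟩ := hF' _ hzW
    exact (G.contDiffAt_symm hz he' (hF _ hzW)).fst.contDiffWithinAt
  · rintro u ⟨huG, huW⟩
    have h1 : G.symm (p u, t u) = (u, 0) := by
      rw [← hF0, ← hGF]
      exact G.left_inv huG
    refine ⟨⟨?_, ?_⟩, by simp only [h1]⟩
    · rw [← hF0, ← hGF]
      exact G.map_source huG
    · rw [Set.mem_preimage, h1]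
      exact huW
  · rintro z ⟨hz, hzW⟩ hzM
    have h1 : F (G.symm z) = z := G.right_inv hz
    obtain ⟨hu, hs⟩ := hzW
    have hs : -1 < (G.symm z).2 := hs
    have h2 : (1 + (G.symm z).2) • p (G.symm z).1 = z.1 := congrArg Prod.fst h1
    have h3 := hzM.1
    rw [← h2, form_smul_left, form_smul_right, (hpM _ hu).1, ← mul_assoc,
      mul_eq_right₀ hε] at h3
    -- Points of `M²(ε)` satisfy `(1 + s)² = 1`, and `s > -1` excludes the root `-2`.
    have h4 : (G.symm z).2 = 0 := by nlinarith
    have h5 : ((G.symm z).1, (0 : ℝ)) = G.symm z := Prod.ext rfl h4.symm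
    refine ⟨?_, by rw [← hF0, h5, h1]⟩
    rw [Set.mem_preimage, h5]
    exact ⟨G.map_target hz, hu, hs⟩

end Straightening

/-! ### The local standard form -/

section LocalStandard

variable {ε : ℝ} {N : Type*} [TopologicalSpace N] [ChartedSpace (EuclideanSpace ℝ (Fin 3)) N]
  {Ψ : N → E6}

lemma differentiable_geodesic (ε : ℝ) : Differentiable ℝ (geodesic ε) := by
  rw [differentiable_pi]
  intro i
  by_cases h : ε = 1
  · simp only [geodesic, if_pos h]
    fin_cases i
    · exact Real.differentiable_cos
    · exact Real.differentiable_sin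
    · exact differentiable_const _
  · simp only [geodesic, if_neg h]
    fin_cases i
    · exact differentiable_const _
    · exact Real.differentiable_sinh
    · exact Real.differentiable_cosh

variable [IsManifold (𝓡 3) ∞ N]

/-- If the second factor `q` of an immersed hypersurface `(p, q)` stays in the geodesic `ν^⊥`, then
`p` and the arc length parameter of `q` are local coordinates. -/
lemma exists_standard_chart (hε : ε = 1 ∨ ε = -1) (x : N) {B : Set (EuclideanSpace ℝ (Fin 3))}
    (hB : IsOpen B) (hBt : B ⊆ (extChartAt (𝓡 3) x).target) (hxB : extChartAt (𝓡 3) x x ∈ B)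
    {p q : EuclideanSpace ℝ (Fin 3) → E3} (hp : ContDiffOn ℝ ∞ p B) (hq : ContDiffOn ℝ ∞ q B)
    (hpM : ∀ u ∈ B, p u ∈ M2 ε) (hqM : ∀ u ∈ B, q u ∈ M2 ε)
    (hpp : ∀ u ∈ B, ∀ v, form ε (fderiv ℝ p u v) (p u) = 0)
    (hpq : ∀ u ∈ B, ∀ v, fderiv ℝ p u v = 0 → fderiv ℝ q u v = 0 → v = 0)
    {ν : E3} (hν : form ε ν ν = 1) (hνq : ∀ u ∈ B, form ε ν (q u) = 0) :
    ∃ (U : Set N) (V : Set (E3 × ℝ)) (φ : N → E3 × ℝ) (ψ : E3 × ℝ → N) (A : E3 ≃ₗ[ℝ] E3),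
      IsOpen U ∧ x ∈ U ∧ IsOpen V ∧
      Set.BijOn φ U (V ∩ M2 ε ×ˢ Set.univ) ∧
      ContMDiffOn (𝓡 3) 𝓘(ℝ, E3 × ℝ) ∞ φ U ∧
      Set.LeftInvOn ψ φ U ∧
      ContMDiffOn 𝓘(ℝ, E3 × ℝ) (𝓡 3) ∞ ψ (V ∩ M2 ε ×ˢ Set.univ) ∧
      (∀ x y, form ε (A x) (A y) = form ε x y) ∧ A '' M2 ε = M2 ε ∧
      ∀ y ∈ U, y ∈ (extChartAt (𝓡 3) x).source ∧ extChartAt (𝓡 3) x y ∈ B ∧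
        p (extChartAt (𝓡 3) x y) = (φ y).1 ∧
        q (extChartAt (𝓡 3) x y) = A (geodesic ε (φ y).2) := by
  set c := extChartAt (𝓡 3) x with hc
  have hV : Module.finrank ℝ (EuclideanSpace ℝ (Fin 3)) = 3 := by simp
  obtain ⟨A, O, t, hA, hAM, hO, hqO, ht, hAt⟩ :=
    exists_geodesic_parameter hε (hqM _ hxB) hν (hνq _ hxB)
  set B₁ := B ∩ q ⁻¹' O with hB₁
  have hB₁o : IsOpen B₁ := hq.continuousOn.isOpen_inter_preimage hB hO
  have hT : ContDiffOn ℝ ∞ (t ∘ q) B₁ := ht.comp (hq.mono Set.inter_subset_left) fun u hu => hu.2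
  have hqA : ∀ u ∈ B₁, q u = A (geodesic ε ((t ∘ q) u)) := fun u hu =>
    hAt _ hu.2 (hqM u hu.1) (hνq u hu.1)
  -- `q` factors through its arc length parameter, so `dq` vanishes wherever the derivative of the
  -- parameter does.
  have hinj : ∀ u ∈ B₁, ∀ v, fderiv ℝ p u v = 0 → fderiv ℝ (t ∘ q) u v = 0 → v = 0 := by
    intro u hu v h1 h2
    refine hpq u hu.1 v h1 ?_
    have hTd : HasFDerivAt (t ∘ q) (fderiv ℝ (t ∘ q) u) u :=
      ((hT.contDiffAt (hB₁o.mem_nhds hu)).differentiableAt (by simp)).hasFDerivAt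
    have h3 := (A.toContinuousLinearEquiv.hasFDerivAt (x := geodesic ε ((t ∘ q) u))).comp u
      (((differentiable_geodesic ε) ((t ∘ q) u)).hasFDerivAt.comp u hTd)
    have h4 := h3.congr_of_eventuallyEq (Filter.eventually_of_mem (hB₁o.mem_nhds hu) hqA)
    rw [h4.fderiv]
    simp [h2]
  obtain ⟨B', O', θ, hB', hB'o, hxB', hO', hθ, hleft, hright⟩ :=
    exists_local_inverse (ne_zero_of_eq_one_or hε) hV hB₁o (hp.mono Set.inter_subset_left) hT
      (fun u hu => hpM u hu.1) (fun u hu => hpp u hu.1) hinj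
      (show c x ∈ B₁ from ⟨hxB, hqO⟩)
  have hU : ∀ y ∈ c.source ∩ c ⁻¹' B', c y ∈ B₁ := fun y hy => hB' hy.2
  refine ⟨c.source ∩ c ⁻¹' B', O', fun y => (p (c y), (t ∘ q) (c y)), c.symm ∘ θ, A, ?_,
    ⟨mem_extChartAt_source x, hxB'⟩, hO', ⟨?_, ?_, ?_⟩, ?_, ?_, ?_, hA, hAM, ?_⟩
  · exact isOpen_extChartAt_preimage' x hB'o
  · exact fun y hy => ⟨(hleft _ hy.2).1, hpM _ (hU y hy).1, trivial⟩
  · intro y hy z hz hyz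
    have h1 := congrArg θ hyz
    simp only [(hleft _ hy.2).2, (hleft _ hz.2).2] at h1
    exact c.injOn hy.1 hz.1 h1
  · rintro z ⟨hz, hzM, -⟩
    obtain ⟨h1, h2⟩ := hright z hz hzM
    have ht := hBt (hB' h1).1
    refine ⟨c.symm (θ z), ⟨c.map_target ht, ?_⟩, ?_⟩
    · rw [Set.mem_preimage, c.right_inv ht]
      exact h1
    · simp only [c.right_inv ht]
      exact h2
  · have h1 : ContDiffOn ℝ ∞ (fun u => (p u, (t ∘ q) u)) B₁ :=
      (hp.mono Set.inter_subset_left).prodMk hT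
    refine h1.contMDiffOn.comp (contMDiffOn_extChartAt.mono fun y hy => ?_) hU
    rw [← extChartAt_source (𝓡 3)]
    exact hy.1
  · intro y hy
    simp only [Function.comp_apply]
    rw [show θ (p (c y), t (q (c y))) = c y from (hleft _ hy.2).2, c.left_inv hy.1]
  · refine (contMDiffOn_extChartAt_symm x).comp (hθ.mono Set.inter_subset_left).contMDiffOn ?_
    rintro z ⟨hz, hzM, -⟩
    exact hBt (hB' (hright z hz hzM).1).1
  · exact fun y hy => ⟨hy.1, (hU y hy).1, rfl, hqA _ (hU y hy)⟩

theorem IsHypersurface.isLocallyStandard (hε : ε = 1 ∨ ε = -1) (hΨ : IsHypersurface ε Ψ)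
    (humb : IsTotallyUmbilical ε Ψ) (hcmc : HasConstantMeanCurvature ε Ψ) :
    IsLocallyStandard ε Ψ := by
  intro x
  have hV : Module.finrank ℝ (EuclideanSpace ℝ (Fin 3)) = 3 := by simp
  obtain ⟨l, B, n, hBt, hxB, hP, -⟩ := hΨ.exists_isUmbilicalPatch hε humb hcmc x
  set f := localExpr Ψ x with hf
  have hn : ∀ u ∈ B, n u = n (extChartAt (𝓡 3) x x) := fun u hu => hP.normal_eq hε hV hu hxB
  have hnt : ∀ u ∈ B, n (extChartAt (𝓡 3) x x) ∈ ambientTangent ε (f u) := fun u hu => by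
    rw [← hn u hu]
    exact (hP.normal u hu).tangent
  have hunit := hP.unit _ hxB
  set m := n (extChartAt (𝓡 3) x x) with hm
  have hd1 : ∀ u ∈ B, ∀ v, fderiv ℝ (fun u => (f u).1) u v = (fderiv ℝ f u v).1 := fun u hu v => by
    rw [(hP.hasFDerivAt hu).fst.fderiv]; rfl
  have hd2 : ∀ u ∈ B, ∀ v, fderiv ℝ (fun u => (f u).2) u v = (fderiv ℝ f u v).2 := fun u hu v => by
    rw [(hP.hasFDerivAt hu).snd.fderiv]; rfl
  have hinj : ∀ u ∈ B, ∀ v, (fderiv ℝ f u v).1 = 0 → (fderiv ℝ f u v).2 = 0 → v = 0 :=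
    fun u hu v h1 h2 => (hP.embedding u hu).injective
      (by rw [map_zero]; exact Prod.ext h1 h2)
  -- Because `n` is constant on `B`, deciding at the base point which factor contains the geodesic
  -- settles it on the whole patch. In the second case the factors are swapped.
  rcases hP.normal_fst_or_snd_eq_zero hε hV hxB with h0 | h0
  · obtain ⟨U, V, φ, ψ, A, h1, h2, h3, h4, h5, h6, h7, hA, hAM, h8⟩ :=
      exists_standard_chart hε x hP.isOpen hBt hxB hP.smooth.fst hP.smooth.snd
        (fun u hu => (hP.embedding u hu).mem.1) (fun u hu => (hP.embedding u hu).mem.2)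
        (fun u hu v => by rw [hd1 u hu]; exact ((hP.embedding u hu).tangent v).1)
        (fun u hu v => by rw [hd1 u hu, hd2 u hu]; exact hinj u hu v)
        (ν := m.2)
        (by simpa [prodForm, show m.1 = 0 from h0] using hunit)
        (fun u hu => (hnt u hu).2)
    refine ⟨U, V, φ, ψ, _, h1, h2, h3, h4, h5, h6, h7, isCongruence_prod A hA hAM, fun y hy => ?_⟩
    obtain ⟨hy, -, h9, h10⟩ := h8 y hy
    rw [← localExpr_apply (Ψ := Ψ) hy]
    exact Prod.ext h9 h10
  · obtain ⟨U, V, φ, ψ, A, h1, h2, h3, h4, h5, h6, h7, hA, hAM, h8⟩ :=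
      exists_standard_chart hε x hP.isOpen hBt hxB hP.smooth.snd hP.smooth.fst
        (fun u hu => (hP.embedding u hu).mem.2) (fun u hu => (hP.embedding u hu).mem.1)
        (fun u hu v => by rw [hd2 u hu]; exact ((hP.embedding u hu).tangent v).2)
        (fun u hu v h1 h2 => hinj u hu v (by rwa [hd1 u hu] at h2) (by rwa [hd2 u hu] at h1))
        (ν := m.1)
        (by simpa [prodForm, show m.2 = 0 from h0] using hunit)
        (fun u hu => (hnt u hu).1)
    refine ⟨U, V, φ, ψ, _, h1, h2, h3, h4, h5, h6, h7, isCongruence_prod_swap A hA hAM,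
      fun y hy => ?_⟩
    obtain ⟨hy, -, h9, h10⟩ := h8 y hy
    rw [← localExpr_apply (Ψ := Ψ) hy]
    exact Prod.ext h10 h9

end LocalStandard

end ProductSurfaces

theorem mainTheorem12 (ε : ℝ) (hε : ε = 1 ∨ ε = -1)
    {N : Type*} [TopologicalSpace N] [ChartedSpace (EuclideanSpace ℝ (Fin 3)) N]
    [IsManifold (𝓡 3) ∞ N] (Ψ : N → ProductSurfaces.E6)
    (hΨ : ProductSurfaces.IsHypersurface ε Ψ)
    (humb : ProductSurfaces.IsTotallyUmbilical ε Ψ)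
    (hcmc : ProductSurfaces.HasConstantMeanCurvature ε Ψ) :
    ProductSurfaces.IsTotallyGeodesic ε Ψ ∧ ProductSurfaces.IsLocallyStandard ε Ψ :=
  ⟨hΨ.isTotallyGeodesic hε humb hcmc, hΨ.isLocallyStandard hε humb hcmc⟩
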